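/- Let $N\ge 1$. For $i\in\{1,\dots,N\}$ let $p_i:\mathbb R^{n_i}\times\mathbb R^{m_i}\to\mathbb R^{n_i}$, $h_i:\mathbb R^{m_i}\to\mathbb R^{n_i}$, $f_i:\mathbb R^{n_i}\times\mathbb R^d\to\mathbb R$, $\phi_i:\mathbb R^{n_i}\to\mathbb R^d$, and let $\mathcal G$ be a digraph on $\{1,\dots,N\}$ with in-neighbour sets $\mathcal N_i=\{j:(j,i)\in\mathcal E\}$ and weights $a_{ij}>0$ if $(j,i)\in\mathcal E$, $a_{ij}=0$ otherwise. For $x=\mathrm{col}(x_1,\dots,x_N)$ and $u=\mathrm{col}(u_1,\dots,u_N)$ put $\sigma(x)=\frac1N\sum_{i}\phi_i(x_i)$, $\Phi(x)=\sum_i f_i(x_i,\sigma(x))$, $h(u)=\mathrm{col}(h_1(u_1),\dots,h_N(u_N))$ and $F_{\sigma,h}(u)=\Phi(h(u))$. Write $\nabla_1f_i,\nabla_2f_i$ for the gradients in the first and second argument, and $\nabla h_i,\nabla\phi_i$ for the transposed Jacobians. Assume: (1) for every $i$ and every $\bar u_i$, $h_i(\bar u_i)$ is a globally exponentially stable equilibrium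 of $\dot x_i=p_i(x_i,\bar u_i)$, with gain and rate independent of $\bar u_i$; $h_i$ is continuously differentiable and globally Lipschitz; $p_i$ is globally Lipschitz in each of its two arguments, uniformly in the other one; (2) $F_{\sigma,h}$ is differentiable and $F_{\sigma,h}(u)\to\infty$ as $\|u\|\to\infty$; $f_i$ is differentiable in each of its arguments, $\phi_i$ is differentiable; and $\nabla\Phi$, $\nabla_1f_i$, $\nabla_2f_i$ (the last two jointly in both arguments) and $\phi_i$ are globally Lipschitz; (3) $\mathcal G$ is strongly connected and weight-balanced: $\sum_j a_{ij}=\sum_j a_{ji}$ for every $i$. For $\alpha_1,\alpha_2>0$ consider the closed-loop system, with states $x_i\in\mathbb R^{n_i}$, $u_i\in\mathbb R^{m_i}$, $w_i,z_i\in\mathbb R^d$ and $s_i=w_i+\phi_i(x_i)$, $g_i=z_i+\nabla_2f_i(x_i,s_i)$, $$\dot x_i=p_i(x_i,u_i),\qquad \dot u_i=-\alpha_1\nabla h_i(u_i)\bigl(\nabla_1f_i(x_i,s_i)+\nabla\phi_i(x_i)\,g_i\bigr),$$ $$\dot w_i=-\frac{\alpha_1}{\alpha_2}\sum_{j\in\mathcal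 N_i}a_{ij}(s_i-s_j),\qquad \dot z_i=-\frac{\alpha_1}{\alpha_2}\sum_{j\in\mathcal N_i}a_{ij}(g_i-g_j).$$ Let $X$ be the set of stationary points of the problem $\min_{x,u}\Phi(x)$ subject to $x=h(u)$, that is, of the $(x,u)$ with $x=h(u)$ at which, for some multiplier $\mu$, the derivative in $(x,u)$ of $\Phi(x)+\mu^\top(x-h(u))$ vanishes. Let $\pi^w(x)$ and $\pi^z(x)$ have the blocks $-\phi_i(x_i)+\sigma(x)$ and $-\nabla_2f_i(x_i,\sigma(x))+\frac1N\sum_j\nabla_2f_j(x_j,\sigma(x))$, and let $\mathcal S=\{(x,u,w,z):\sum_iw_i=0,\ \sum_iz_i=0\}$. Then there are $\bar\alpha_1,\bar\alpha_2>0$ such that for all $\alpha_1\in(0,\bar\alpha_1)$ and $\alpha_2\in(0,\bar\alpha_2)$: (a) every trajectory, on any interval $[0,T)$ with $T\le\infty$, that starts with $w(0)=z(0)=0$ (and arbitrary $x(0)$, $u(0)$) is bounded; and every such trajectory on $[0,\infty)$ satisfies $$\lim_{t\to\infty}\operatorname{dist}\Bigl(\bigl(x(t),u(t),w(t)-\pi^w(x(t)),z(t)-\pi^z(x(t))\bigr),\;X\times\{0\}\Bigr)=0,$$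 where the distance to the empty set is $+\infty$; (b) if all $\nabla h_i$ and $\nabla\phi_i$ are moreover locally Lipschitz, then from every initial condition in $\mathcal S$ there is a trajectory on $[0,\infty)$; (c) for every $\bar u$ that is an isolated stationary point and a local minimum of $F_{\sigma,h}$, the point $\bigl(h(\bar u),\bar u,\pi^w(h(\bar u)),\pi^z(h(\bar u))\bigr)$ is a locally asymptotically stable equilibrium of the closed-loop system restricted to the forward-invariant set $\mathcal S$. -/

import Mathlib

open Set Filter Topology Bornology
open scoped InnerProductSpace Gradient

noncomputable section

/-! Trajectories of autonomous differential equations and their stability -/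

/-- The curve `q` solves `q' = v q` on the set of times `J`
(with one-sided derivatives at the end points of `J`). -/
def IsSolutionOn {E : Type*} [NormedAddCommGroup E] [NormedSpace ℝ E]
    (v : E → E) (J : Set ℝ) (q : ℝ → E) : Prop :=
  ∀ t ∈ J, HasDerivWithinAt q (v (q t)) J t

/-- The time interval `[0, T)`, where `T = ⊤` is allowed and gives `[0, ∞)`. -/
def timeInterval (T : EReal) : Set ℝ :=
  {t | 0 ≤ t ∧ (t : EReal) < T}

/-- For every constant input `u`, the point `h u` is a globally exponentially stable equilibrium of
`x' = p x u`, with gain and decay rate that do not depend on `u`. -/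
def UniformlyGloballyExponentiallyStable {E U : Type*} [NormedAddCommGroup E] [NormedSpace ℝ E]
    (p : E → U → E) (h : U → E) : Prop :=
  (∀ u, p (h u) u = 0) ∧
  ∃ k > (0 : ℝ), ∃ r > (0 : ℝ), ∀ (u : U) (q : ℝ → E),
    IsSolutionOn (fun x => p x u) (timeInterval ⊤) q →
      ∀ t, 0 ≤ t → ‖q t - h u‖ ≤ k * Real.exp (-r * t) * ‖q 0 - h u‖

/-- The point `e` is a locally asymptotically stable equilibrium of the restriction of
`q' = v q` to the forward-invariant set `S`. -/
structure IsLocallyAsymptoticallyStableOn {E : Type*} [NormedAddCommGroup E] [NormedSpace ℝ E]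
    (v : E → E) (S : Set E) (e : E) : Prop where
  mem : e ∈ S
  equilibrium : v e = 0
  invariant : ∀ (T : EReal) (q : ℝ → E), IsSolutionOn v (timeInterval T) q → q 0 ∈ S →
    ∀ t ∈ timeInterval T, q t ∈ S
  stable : ∀ ε > (0 : ℝ), ∃ δ > (0 : ℝ), ∀ (T : EReal) (q : ℝ → E),
    IsSolutionOn v (timeInterval T) q → q 0 ∈ S → dist (q 0) e < δ →
      ∀ t ∈ timeInterval T, dist (q t) e < ε
  attractive : ∃ δ > (0 : ℝ), ∀ q : ℝ → E,
    IsSolutionOn v (timeInterval ⊤) q → q 0 ∈ S → dist (q 0) e < δ →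
      Tendsto q atTop (𝓝 e)

/-- `u` is a stationary point of `J` and has a neighbourhood without any other one. -/
def IsIsolatedStationaryPoint {E : Type*} [NormedAddCommGroup E] [InnerProductSpace ℝ E]
    [CompleteSpace E] (J : E → ℝ) (u : E) : Prop :=
  ∇ J u = 0 ∧ ∀ᶠ u' in 𝓝[≠] u, ∇ J u' ≠ 0

/-! The network -/

/-- Column vectors `col(v₁, …, v_N)` with blocks `v_i ∈ ℝ^{k_i}`, with the Euclidean norm. -/
abbrev Stack (N : ℕ) (k : Fin N → ℕ) : Type :=
  PiLp 2 (fun i : Fin N => EuclideanSpace ℝ (Fin (k i)))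

/-- The data of a network of `N` agents: plants, steady-state maps, local costs, contributions to
the aggregative variable, and a weighted communication digraph, in which `graph.Adj j i` says that
`(j, i)` is an edge (agent `i` receives from agent `j`), and then `weight i j` is positive. -/
structure AgentNetwork (N : ℕ) (n m : Fin N → ℕ) (d : ℕ) where
  /-- plant dynamics `p_i(x_i, u_i)` -/
  p : ∀ i, EuclideanSpace ℝ (Fin (n i)) → EuclideanSpace ℝ (Fin (m i)) →
    EuclideanSpace ℝ (Fin (n i))
  /-- steady-state maps `h_i(u_i)` -/
  h : ∀ i, EuclideanSpace ℝ (Fin (m i)) → EuclideanSpace ℝ (Fin (n i))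
  /-- local costs `f_i(x_i, y_i)` -/
  f : ∀ i, EuclideanSpace ℝ (Fin (n i)) → EuclideanSpace ℝ (Fin d) → ℝ
  /-- contributions `φ_i(x_i)` to the aggregative variable -/
  φ : ∀ i, EuclideanSpace ℝ (Fin (n i)) → EuclideanSpace ℝ (Fin d)
  /-- communication digraph -/
  graph : Digraph (Fin N)
  /-- weighted adjacency matrix -/
  weight : Matrix (Fin N) (Fin N) ℝ
  weight_pos : ∀ i j, graph.Adj j i → 0 < weight i j
  weight_zero : ∀ i j, ¬ graph.Adj j i → weight i j = 0

namespace AgentNetwork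

variable {N : ℕ} {n m : Fin N → ℕ} {d : ℕ} (P : AgentNetwork N n m d)

/-- The aggregation function `σ(x) = (1/N) ∑ φ_i(x_i)`. -/
def sigma (x : Stack N n) : EuclideanSpace ℝ (Fin d) :=
  (1 / (N : ℝ)) • ∑ i, P.φ i (x i)

/-- `x ↦ F(x, σ(x)) = ∑ f_i(x_i, σ(x))`. -/
def cost (x : Stack N n) : ℝ := ∑ i, P.f i (x i) (P.sigma x)

/-- The stacked steady-state map `h(u) = col(h_1(u_1), …, h_N(u_N))`. -/
def steady (u : Stack N m) : Stack N n := WithLp.toLp 2 fun i => P.h i (u i)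

/-- `F_{σ,h}(u) = F(h(u), σ(h(u)))`. -/
def reducedCost (u : Stack N m) : ℝ := P.cost (P.steady u)

/-- The gradient of `f_i` in the first argument, at `(x_i, y_i)`. -/
def grad1 (i : Fin N) (x : EuclideanSpace ℝ (Fin (n i))) (y : EuclideanSpace ℝ (Fin d)) :
    EuclideanSpace ℝ (Fin (n i)) :=
  ∇ (fun s => P.f i s y) x

/-- The gradient of `f_i` in the second argument, at `(x_i, y_i)`. -/
def grad2 (i : Fin N) (x : EuclideanSpace ℝ (Fin (n i))) (y : EuclideanSpace ℝ (Fin d)) :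
    EuclideanSpace ℝ (Fin d) :=
  ∇ (fun s => P.f i x s) y

/-- `∇h_i(u_i)`, the transpose of the Jacobian of `h_i`. -/
def gradh (i : Fin N) (u : EuclideanSpace ℝ (Fin (m i))) :
    EuclideanSpace ℝ (Fin (n i)) →L[ℝ] EuclideanSpace ℝ (Fin (m i)) :=
  ContinuousLinearMap.adjoint (fderiv ℝ (P.h i) u)

/-- `∇φ_i(x_i)`, the transpose of the Jacobian of `φ_i`. -/
def gradφ (i : Fin N) (x : EuclideanSpace ℝ (Fin (n i))) :
    EuclideanSpace ℝ (Fin d) →L[ℝ] EuclideanSpace ℝ (Fin (n i)) :=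
  ContinuousLinearMap.adjoint (fderiv ℝ (P.φ i) x)

open scoped Classical in
/-- The in-neighbours of agent `i`. -/
def inNeighbors (i : Fin N) : Finset (Fin N) := {j | P.graph.Adj j i}

open scoped Classical in
/-- The out-neighbours of agent `i`. -/
def outNeighbors (i : Fin N) : Finset (Fin N) := {j | P.graph.Adj i j}

/-- The plants have uniformly globally exponentially stable steady states `h_i(u_i)`; `h_i` is
globally Lipschitz and continuously differentiable, and `p_i` is globally Lipschitz. -/
structure SteadyStateAssumption : Prop where
  stable : ∀ i, UniformlyGloballyExponentiallyStable (P.p i) (P.h i)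
  smooth : ∀ i, ContDiff ℝ 1 (P.h i)
  lipschitz_h : ∃ Lh > (0 : ℝ), ∀ i u u', ‖P.h i u - P.h i u'‖ ≤ Lh * ‖u - u'‖
  lipschitz_p : ∃ Lp > (0 : ℝ), ∀ i,
    (∀ x x' u, ‖P.p i x u - P.p i x' u‖ ≤ Lp * ‖x - x'‖) ∧
    (∀ x u u', ‖P.p i x u - P.p i x u'‖ ≤ Lp * ‖u - u'‖)

/-- Regularity of the costs and of the contributions to the aggregative variable. -/
structure CostAssumption : Prop where
  radially_unbounded : Tendsto P.reducedCost (cobounded (Stack N m)) atTop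
  differentiable_reduced : Differentiable ℝ P.reducedCost
  differentiable1 : ∀ i y, Differentiable ℝ (fun x => P.f i x y)
  differentiable2 : ∀ i x, Differentiable ℝ (fun y => P.f i x y)
  differentiable_φ : ∀ i, Differentiable ℝ (P.φ i)
  lipschitz_cost : ∃ L0 > (0 : ℝ), ∀ x x', ‖∇ P.cost x - ∇ P.cost x'‖ ≤ L0 * ‖x - x'‖
  lipschitz1 : ∃ L1 > (0 : ℝ), ∀ i x x' y y',
    ‖P.grad1 i x y - P.grad1 i x' y'‖ ≤ L1 * √(‖x - x'‖ ^ 2 + ‖y - y'‖ ^ 2)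
  lipschitz2 : ∃ L2 > (0 : ℝ), ∀ i x x' y y',
    ‖P.grad2 i x y - P.grad2 i x' y'‖ ≤ L2 * √(‖x - x'‖ ^ 2 + ‖y - y'‖ ^ 2)
  lipschitz_φ : ∃ L3 > (0 : ℝ), ∀ i x x', ‖P.φ i x - P.φ i x'‖ ≤ L3 * ‖x - x'‖

/-- The communication digraph is strongly connected and weight-balanced. -/
structure GraphAssumption : Prop where
  strongly_connected : ∀ i j, Relation.ReflTransGen P.graph.Adj i j
  weight_balanced : ∀ i,
    ∑ j ∈ P.inNeighbors i, P.weight i j = ∑ j ∈ P.outNeighbors i, P.weight j i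

/-- The set `X` of stationary points of: minimize `F(x, σ(x))` over `(x, u)` subject to
`x = h(u)`. These are the feasible points at which, for some multiplier `μ`, the derivative of the
Lagrangian in `(x, u)` vanishes. -/
def stationarySet : Set (Stack N n × Stack N m) :=
  {s | s.1 = P.steady s.2 ∧ ∃ μ : Stack N n,
    HasFDerivAt (fun r : Stack N n × Stack N m => P.cost r.1 + ⟪μ, r.1 - P.steady r.2⟫_ℝ)
      (0 : Stack N n × Stack N m →L[ℝ] ℝ) s}

/-- The point `π^w(x)`. -/
def piw (x : Stack N n) : Stack N (fun _ => d) :=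
  WithLp.toLp 2 fun i => -P.φ i (x i) + P.sigma x

/-- The point `π^z(x)`. -/
def piz (x : Stack N n) : Stack N (fun _ => d) :=
  WithLp.toLp 2 fun i => -P.grad2 i (x i) (P.sigma x)
    + (1 / (N : ℝ)) • ∑ j, P.grad2 j (x j) (P.sigma x)

end AgentNetwork

/-- States `((x, u), (w, z))` of the closed loop. -/
abbrev ClosedLoopState (N : ℕ) (n m : Fin N → ℕ) (d : ℕ) : Type :=
  (Stack N n × Stack N m) × (Stack N (fun _ => d) × Stack N (fun _ => d))

namespace AgentNetwork

variable {N : ℕ} {n m : Fin N → ℕ} {d : ℕ} (P : AgentNetwork N n m d)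

/-- The right-hand side of the closed-loop system. -/
def closedLoop (α₁ α₂ : ℝ) (q : ClosedLoopState N n m d) : ClosedLoopState N n m d :=
  let x := q.1.1
  let u := q.1.2
  let w := q.2.1
  let z := q.2.2
  -- the estimates of the aggregative variable
  let s : Fin N → EuclideanSpace ℝ (Fin d) := fun i => w i + P.φ i (x i)
  -- the estimates of the average gradient in the second argument
  let g : Fin N → EuclideanSpace ℝ (Fin d) := fun i => z i + P.grad2 i (x i) (s i)
  ((WithLp.toLp 2 fun i => P.p i (x i) (u i),
    WithLp.toLp 2 fun i =>
      -(α₁ • P.gradh i (u i) (P.grad1 i (x i) (s i) + P.gradφ i (x i) (g i)))),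
   (WithLp.toLp 2 fun i =>
      -((α₁ / α₂) • ∑ j ∈ P.inNeighbors i, P.weight i j • (s i - s j)),
    WithLp.toLp 2 fun i =>
      -((α₁ / α₂) • ∑ j ∈ P.inNeighbors i, P.weight i j • g i)
        + (α₁ / α₂) • ∑ j ∈ P.inNeighbors i, P.weight i j • g j))

/-- The error vector `((x, u), (w - π^w(x), z - π^z(x)))`. -/
def errorVector (q : ClosedLoopState N n m d) : ClosedLoopState N n m d :=
  (q.1, (q.2.1 - P.piw q.1.1, q.2.2 - P.piz q.1.1))

end AgentNetwork

/-- The set `S` of the states such that the blocks of `w` and those of `z` sum to zero. -/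
def zeroSumSet (N : ℕ) (n m : Fin N → ℕ) (d : ℕ) : Set (ClosedLoopState N n m d) :=
  {q | ∑ i, q.2.1 i = 0 ∧ ∑ i, q.2.2 i = 0}

end

open Set Filter Topology Bornology
open scoped InnerProductSpace Gradient

noncomputable section

/-! Solutions of autonomous differential equations: restriction, uniqueness, existence -/

/-! The closed loop has separated time scales. The input moves at rate `α₁`, slowly compared with
the plants; the consensus estimators run at rate `α₁ / α₂`, fast compared with the input when `α₂`
is small. Weight balance keeps the sums of `w` and `z` at zero, so on `zeroSumSet` the average of
the `s_i` is exactly `σ(x)`. With exact tracking and no disagreement the input would follow the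
gradient flow of the reduced cost.

Let `D` be the norm of the gradient of the reduced cost at `u`, `X` a Lyapunov function `W x u` of
the plants, and `Y`, `Z` the norms of the deviations of `s` and `g` from their averages. The input
follows the gradient flow up to an error of order `X + Y + Z`
(`exists_norm_gradSteady_direction_sub_le`). `W` comes from a converse Lyapunov theorem
(`UniformlyGloballyExponentiallyStable.exists_isPlantLyapunov`), and `Y`, `Z` decay because the
Laplacian is positive definite on zero-sum vectors (`exists_hasUpperDerivAt_disagreement`). The
derivative of reduced cost `+ a X² + b Y² + c Z²` is then bounded by a quadratic form in `D, X, Y,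
Z`, which `exists_composite_weights` makes negative definite; `exists_isDissipatedOn` collects this.

Sublevel sets of this function in `zeroSumSet` are bounded, as the reduced cost is radially
unbounded. This gives boundedness, and global existence when the field is locally Lipschitz. The
dissipation rate vanishes only at exact steady states with stationary input, whence convergence by a
LaSalle argument. An isolated stationary local minimum is a strict one, so there Lyapunov's theorem
applies relative to `zeroSumSet`.

Two losses of regularity shape the arguments. `W` and the `∇₂f_i` are only Lipschitz, so derivatives
along solutions are replaced by differentiable majorants touching at one time. The `∇φ_i` need not
be continuous, so neither is the field: convergence and stability use only its boundedness on
compact sets, with no uniqueness and no invariance of limit sets. -/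

lemma LocallyLipschitz.exists_lipschitzOnWith_closedBall {E : Type*}
    [NormedAddCommGroup E] [ProperSpace E] {v : E → E} (hv : LocallyLipschitz v) (R : ℝ) :
    ∃ K, LipschitzOnWith K v (Metric.closedBall 0 R) :=
  LocallyLipschitzOn.exists_lipschitzOnWith_of_compact (isCompact_closedBall 0 R)
    hv.locallyLipschitzOn

section Solutions

variable {E : Type*} [NormedAddCommGroup E] [NormedSpace ℝ E] {v : E → E} {q : ℝ → E}

lemma IsSolutionOn.mono {J J' : Set ℝ} (h : IsSolutionOn v J q) (hJ : J' ⊆ J) :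
    IsSolutionOn v J' q := fun t ht => (h t (hJ ht)).mono hJ

lemma IsSolutionOn.continuousOn {J : Set ℝ} (h : IsSolutionOn v J q) : ContinuousOn q J :=
  fun t ht => (h t ht).continuousWithinAt

lemma IsSolutionOn.congr {J : Set ℝ} {q' : ℝ → E} (h : IsSolutionOn v J q) (hq : EqOn q' q J) :
    IsSolutionOn v J q' := fun t ht => by
  rw [hq ht]
  exact (h t ht).congr hq (hq ht)

lemma IsSolutionOn.hasDerivWithinAt_Ici {a b : ℝ} (h : IsSolutionOn v (Icc a b) q) {t : ℝ}
    (ht : t ∈ Ico a b) : HasDerivWithinAt q (v (q t)) (Ici t) t :=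
  (h t ⟨ht.1, ht.2.le⟩).mono_of_mem_nhdsWithin (Icc_mem_nhdsGE_of_mem ht)

lemma timeInterval_top : timeInterval ⊤ = Ici (0 : ℝ) := by
  ext t; simp [timeInterval, EReal.coe_lt_top]

lemma Icc_subset_timeInterval {T : EReal} {t : ℝ} (ht : t ∈ timeInterval T) :
    Icc 0 t ⊆ timeInterval T := fun _ hs =>
  ⟨hs.1, lt_of_le_of_lt (EReal.coe_le_coe_iff.2 hs.2) ht.2⟩

lemma IsSolutionOn.shift {a b : ℝ} (ha : 0 ≤ a) (h : IsSolutionOn v (Icc 0 (a + b)) q) :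
    IsSolutionOn v (Icc 0 b) (fun t => q (a + t)) := by
  intro t ht
  have h1 : HasDerivWithinAt (fun s : ℝ => a + s) 1 (Icc 0 b) t := by
    simpa using ((hasDerivAt_id t).const_add a).hasDerivWithinAt
  have h2 := (h (a + t) ⟨by linarith [ht.1], by linarith [ht.2]⟩).scomp t h1
    (fun s hs => ⟨by linarith [hs.1], by linarith [hs.2]⟩)
  simpa [Function.comp_def] using h2

lemma IsSolutionOn.exists_concat {a b : ℝ} {q₁ q₂ : ℝ → E} (ha : 0 ≤ a) (hb : 0 ≤ b)
    (h₁ : IsSolutionOn v (Icc 0 a) q₁) (h₂ : IsSolutionOn v (Icc 0 b) q₂) (h : q₂ 0 = q₁ a) :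
    ∃ q, IsSolutionOn v (Icc 0 (a + b)) q ∧ q 0 = q₁ 0 := by
  set q : ℝ → E := fun t => if t ≤ a then q₁ t else q₂ (t - a) with hq
  have e1 : EqOn q q₁ (Icc 0 a) := fun t ht => by simp [hq, ht.2]
  have e2 : EqOn q (fun t => q₂ (t - a)) (Icc a (a + b)) := fun t ht => by
    rcases ht.1.eq_or_lt with rfl | h'
    · simp [hq, h]
    · simp [hq, not_le.2 h']
  have s1 : IsSolutionOn v (Icc 0 a) q := h₁.congr e1
  have s2 : IsSolutionOn v (Icc a (a + b)) q := by
    refine IsSolutionOn.congr (q := fun t => q₂ (t - a)) (fun t ht => ?_) e2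
    have h1 : HasDerivWithinAt (fun s : ℝ => s - a) 1 (Icc a (a + b)) t := by
      simpa using ((hasDerivAt_id t).sub_const a).hasDerivWithinAt
    have h2 := (h₂ (t - a) ⟨by linarith [ht.1], by linarith [ht.2]⟩).scomp t h1
      (show MapsTo _ _ (Icc 0 b) from
        fun _ hs => ⟨by linarith [hs.1], by linarith [hs.2]⟩)
    simpa [Function.comp_def] using h2
  refine ⟨q, fun t ht => ?_, e1 ⟨le_rfl, ha⟩⟩
  rcases lt_trichotomy t a with hta | rfl | hta
  · refine (s1 t ⟨ht.1, hta.le⟩).mono_of_mem_nhdsWithin ?_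
    filter_upwards [self_mem_nhdsWithin, mem_nhdsWithin_of_mem_nhds (Iio_mem_nhds hta)] with s hs hs'
    exact ⟨hs.1, le_of_lt hs'⟩
  -- At the junction both one-sided derivatives equal the field at the common state, so they combine
  -- to a derivative on the union.
  · have := (s1 t ⟨ht.1, le_rfl⟩).union (s2 t ⟨le_rfl, ht.2⟩)
    rwa [Icc_union_Icc_eq_Icc ha (by linarith)] at this
  · refine (s2 t ⟨hta.le, ht.2⟩).mono_of_mem_nhdsWithin ?_
    filter_upwards [self_mem_nhdsWithin, mem_nhdsWithin_of_mem_nhds (Ioi_mem_nhds hta)] with s hs hs'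
    exact ⟨le_of_lt hs', hs.2⟩

variable [ProperSpace E]

lemma IsSolutionOn.eqOn (hv : LocallyLipschitz v) {b : ℝ} {q₁ q₂ : ℝ → E}
    (h₁ : IsSolutionOn v (Icc 0 b) q₁) (h₂ : IsSolutionOn v (Icc 0 b) q₂) (h : q₁ 0 = q₂ 0) :
    EqOn q₁ q₂ (Icc 0 b) := by
  obtain ⟨R₁, hR₁⟩ := (isCompact_Icc.image_of_continuousOn h₁.continuousOn).isBounded.subset_closedBall 0
  obtain ⟨R₂, hR₂⟩ := (isCompact_Icc.image_of_continuousOn h₂.continuousOn).isBounded.subset_closedBall 0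
  obtain ⟨K, hK⟩ := hv.exists_lipschitzOnWith_closedBall (max R₁ R₂)
  refine ODE_solution_unique_of_mem_Icc_right (v := fun _ => v)
    (s := fun _ => Metric.closedBall 0 (max R₁ R₂)) (fun _ _ => hK) h₁.continuousOn
    (fun t ht => h₁.hasDerivWithinAt_Ici ht) (fun t ht => ?_) h₂.continuousOn
    (fun t ht => h₂.hasDerivWithinAt_Ici ht) (fun t ht => ?_) h
  · exact Metric.closedBall_subset_closedBall (le_max_left _ _) (hR₁ ⟨t, ⟨ht.1, ht.2.le⟩, rfl⟩)
  · exact Metric.closedBall_subset_closedBall (le_max_right _ _) (hR₂ ⟨t, ⟨ht.1, ht.2.le⟩, rfl⟩)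

lemma LocallyLipschitz.exists_isSolutionOn_uniform (hv : LocallyLipschitz v) (R : ℝ) :
    ∃ τ > (0 : ℝ), ∀ x₀, ‖x₀‖ ≤ R → ∃ q, IsSolutionOn v (Icc 0 τ) q ∧ q 0 = x₀ := by
  obtain ⟨K, hK⟩ := hv.exists_lipschitzOnWith_closedBall (R + 1)
  obtain ⟨M, hM⟩ := (isCompact_closedBall (0 : E) (R + 1)).exists_bound_of_continuousOn
    hv.continuous.continuousOn
  have hL : 0 < |M| + 1 := by positivity
  -- A solution of speed at most `|M|` cannot leave the unit ball about `x₀` within this time, which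
  -- depends on `R` only.
  refine ⟨1 / (|M| + 1), by positivity, fun x₀ hx₀ => ?_⟩
  have hτ : (0 : ℝ) ≤ 1 / (|M| + 1) := by positivity
  have hsub : Metric.closedBall x₀ ((1 : NNReal) : ℝ) ⊆ Metric.closedBall 0 (R + 1) := by
    refine Metric.closedBall_subset_closedBall' ?_
    simp; linarith
  have hpl : IsPicardLindelof (fun _ : ℝ => v) (⟨0, le_rfl, hτ⟩ : Icc (0 : ℝ) (1 / (|M| + 1)))
      x₀ 1 0 (.mk (|M| + 1) hL.le) K := by
    refine IsPicardLindelof.of_time_independent (fun x hx => ?_) (hK.mono hsub) ?_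
    · exact (hM x (hsub hx)).trans ((le_abs_self M).trans (by simp))
    · change (|M| + 1) * max (1 / (|M| + 1) - 0) (0 - 0) ≤ 1 - 0
      rw [sub_zero, sub_zero, sub_zero, max_eq_left hτ, mul_one_div_cancel hL.ne']
  obtain ⟨q, hq0, hq⟩ := hpl.exists_eq_forall_mem_Icc_hasDerivWithinAt₀
  exact ⟨q, hq, hq0⟩

/-- A priori bounds imply existence on compact time intervals. -/
lemma LocallyLipschitz.exists_isSolutionOn_Icc (hv : LocallyLipschitz v) {x₀ : E} {T R : ℝ}
    (hT : 0 ≤ T) (hR : ∀ T' ∈ Icc 0 T, ∀ q, IsSolutionOn v (Icc 0 T') q → q 0 = x₀ → ‖q T'‖ ≤ R) :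
    ∃ q, IsSolutionOn v (Icc 0 T) q ∧ q 0 = x₀ := by
  obtain ⟨τ, hτ, hstep⟩ := hv.exists_isSolutionOn_uniform R
  -- The a priori bound holds at the end point of each piece, so the step `τ` never has to shrink.
  have key : ∀ k : ℕ, ∃ q, IsSolutionOn v (Icc 0 (min T (k * τ))) q ∧ q 0 = x₀ := by
    intro k
    induction k with
    | zero =>
      refine ⟨fun _ => x₀, fun t ht => ?_, rfl⟩
      have h0 : Icc 0 (min T (((0 : ℕ) : ℝ) * τ)) = {0} := by simp [hT]
      rw [h0] at ht ⊢
      rw [mem_singleton_iff.1 ht]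
      exact hasDerivWithinAt_iff_hasFDerivWithinAt.2 .singleton
    | succ k ih =>
      obtain ⟨q₁, h₁, h10⟩ := ih
      have ha : 0 ≤ min T (k * τ) := le_min hT (by positivity)
      obtain ⟨q₂, h₂, h20⟩ := hstep (q₁ (min T (k * τ)))
        (hR _ ⟨ha, min_le_left _ _⟩ q₁ h₁ h10)
      obtain ⟨q, hq, hq0⟩ := h₁.exists_concat ha hτ.le h₂ h20
      refine ⟨q, hq.mono (Icc_subset_Icc_right ?_), hq0.trans h10⟩
      push_cast
      rcases le_total T (k * τ) with h | h
      · rw [min_eq_left h]; exact (min_le_left _ _).trans (by linarith)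
      · rw [min_eq_right h]; exact (min_le_right _ _).trans (by linarith)
  obtain ⟨k, hk⟩ := exists_nat_ge (T / τ)
  obtain ⟨q, hq⟩ := key k
  rw [min_eq_left ((div_le_iff₀ hτ).1 hk)] at hq
  exact ⟨q, hq⟩

/-- A priori bounds imply global existence. -/
lemma LocallyLipschitz.exists_isSolutionOn_timeInterval_top (hv : LocallyLipschitz v) {x₀ : E}
    (hR : ∀ T, ∃ R, ∀ T' ∈ Icc 0 T, ∀ q, IsSolutionOn v (Icc 0 T') q → q 0 = x₀ → ‖q T'‖ ≤ R) :
    ∃ q, IsSolutionOn v (timeInterval ⊤) q ∧ q 0 = x₀ := by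
  have hex : ∀ T : ℕ, ∃ q, IsSolutionOn v (Icc 0 T) q ∧ q 0 = x₀ := fun T => by
    obtain ⟨R, hR⟩ := hR T
    exact hv.exists_isSolutionOn_Icc (Nat.cast_nonneg T) hR
  choose Q hQ hQ0 using hex
  -- By uniqueness all solutions whose interval contains `t` agree there, so any index above `t`
  -- would do.
  set q : ℝ → E := fun t => Q (⌈t⌉₊ + 1) t with hq
  have hqQ : ∀ k : ℕ, EqOn q (Q k) (Icc 0 k) := fun k t ht => by
    rcases le_total k (⌈t⌉₊ + 1) with h | h
    · exact ((hQ _).mono (Icc_subset_Icc_right (by exact_mod_cast h))).eqOn hv (hQ k)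
        (by rw [hQ0, hQ0]) ht
    · refine (hQ _).eqOn hv ((hQ k).mono (Icc_subset_Icc_right (by exact_mod_cast h)))
        (by rw [hQ0, hQ0]) ⟨ht.1, ?_⟩
      push_cast
      linarith [Nat.le_ceil t]
  refine ⟨q, fun t ht => ?_, (hqQ 0 (by simp)).trans (hQ0 0)⟩
  rw [timeInterval_top] at ht ⊢
  obtain ⟨k, hk⟩ := exists_nat_gt t
  refine (((hQ k).congr (hqQ k)) t ⟨ht, hk.le⟩).mono_of_mem_nhdsWithin ?_
  filter_upwards [self_mem_nhdsWithin, mem_nhdsWithin_of_mem_nhds (Iio_mem_nhds hk)] with s hs hs'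
  exact ⟨hs, le_of_lt hs'⟩

/-- A globally Lipschitz field grows at most linearly, and Grönwall's inequality turns this into the
a priori bound. -/
lemma LipschitzWith.exists_isSolutionOn_timeInterval_top {K : NNReal} (hv : LipschitzWith K v)
    (x₀ : E) : ∃ q, IsSolutionOn v (timeInterval ⊤) q ∧ q 0 = x₀ := by
  refine hv.locallyLipschitz.exists_isSolutionOn_timeInterval_top fun T =>
    ⟨gronwallBound ‖x₀‖ K ‖v 0‖ T, fun T' hT' q hq h0 => ?_⟩
  have h := norm_le_gronwallBound_of_norm_deriv_right_le (δ := ‖x₀‖) (K := K) (ε := ‖v 0‖)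
    hq.continuousOn (fun t ht => hq.hasDerivWithinAt_Ici ht) (by rw [h0]) (fun t _ => ?_) T'
    ⟨hT'.1, le_rfl⟩
  · rw [sub_zero] at h
    exact h.trans (gronwallBound_mono (norm_nonneg _) (norm_nonneg _) K.2 hT'.2)
  · have := hv.dist_le_mul (q t) 0
    rw [dist_eq_norm, dist_zero_right] at this
    calc ‖v (q t)‖ = ‖(v (q t) - v 0) + v 0‖ := by rw [sub_add_cancel]
      _ ≤ _ := (norm_add_le _ _).trans (by linarith)

end Solutions

/-! Upper right derivatives -/

/-- The function `f` has at `t` an upper right derivative of at most `b`, as witnessed by a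
differentiable majorant. -/
def HasUpperDerivAt (f : ℝ → ℝ) (b t : ℝ) : Prop :=
  ∃ B : ℝ → ℝ, HasDerivWithinAt B b (Ici t) t ∧ B t = f t ∧ ∀ᶠ s in 𝓝[>] t, f s ≤ B s

namespace HasUpperDerivAt

lemma of_hasDerivWithinAt {f : ℝ → ℝ} {b t : ℝ} (h : HasDerivWithinAt f b (Ici t) t) :
    HasUpperDerivAt f b t := ⟨f, h, rfl, Eventually.of_forall fun _ => le_rfl⟩

lemma add {f g : ℝ → ℝ} {b c t : ℝ} (hf : HasUpperDerivAt f b t) (hg : HasUpperDerivAt g c t) :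
    HasUpperDerivAt (fun s => f s + g s) (b + c) t := by
  obtain ⟨B, hB, hBt, hBf⟩ := hf
  obtain ⟨C, hC, hCt, hCg⟩ := hg
  refine ⟨fun s => B s + C s, hB.add hC, by simp [hBt, hCt], ?_⟩
  filter_upwards [hBf, hCg] with s h1 h2 using add_le_add h1 h2

lemma const_mul {f : ℝ → ℝ} {b t a : ℝ} (ha : 0 ≤ a) (hf : HasUpperDerivAt f b t) :
    HasUpperDerivAt (fun s => a * f s) (a * b) t := by
  obtain ⟨B, hB, hBt, hBf⟩ := hf
  refine ⟨fun s => a * B s, hB.const_mul a, by simp [hBt], ?_⟩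
  filter_upwards [hBf] with s h1 using mul_le_mul_of_nonneg_left h1 ha

lemma sq {f : ℝ → ℝ} {b t : ℝ} (h0 : ∀ s, 0 ≤ f s) (hf : HasUpperDerivAt f b t) :
    HasUpperDerivAt (fun s => f s ^ 2) (2 * f t * b) t := by
  obtain ⟨B, hB, hBt, hBf⟩ := hf
  refine ⟨fun s => B s ^ 2, by simpa [hBt, Pi.pow_def] using hB.pow 2, by simp [hBt], ?_⟩
  filter_upwards [hBf] with s h1 using pow_le_pow_left₀ (h0 s) h1 2

lemma frequently_slope_lt {f : ℝ → ℝ} {b t r : ℝ} (hf : HasUpperDerivAt f b t) (hr : b < r) :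
    ∃ᶠ s in 𝓝[>] t, slope f t s < r := by
  obtain ⟨B, hB, hBt, hBf⟩ := hf
  refine Eventually.frequently ?_
  have h := (hasDerivWithinAt_iff_tendsto_slope.1 hB)
  rw [Ici_sdiff_left] at h
  filter_upwards [h.eventually_lt_const hr, hBf, self_mem_nhdsWithin] with s h1 h2 h3
  refine lt_of_le_of_lt ?_ h1
  have h3 : 0 < s - t := sub_pos.2 h3
  rw [slope_def_field, slope_def_field, hBt]
  gcongr

end HasUpperDerivAt

/-- The majorants control the right slopes of `f`, and a continuous function is compared with the
line of slope `-c` through its initial value by means of right slopes alone. -/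
lemma le_sub_of_hasUpperDerivAt {f b : ℝ → ℝ} {s t c : ℝ} (hst : s ≤ t)
    (hf : ContinuousOn f (Icc s t)) (hb : ∀ x ∈ Ico s t, HasUpperDerivAt f (b x) x)
    (hc : ∀ x ∈ Ico s t, b x ≤ -c) : f t ≤ f s - c * (t - s) := by
  have := image_le_of_liminf_slope_right_le_deriv_boundary (B := fun x => f s - c * (x - s))
    (B' := fun _ => -c) hf (by simp) (by fun_prop) (fun x _ => by
      simpa using ((((hasDerivAt_id x).sub_const s).const_mul c).const_sub (f s)).hasDerivWithinAt)
    (fun x hx r hr => (hb x hx).frequently_slope_lt ((hc x hx).trans_lt hr)) (x := t)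
    ⟨hst, le_rfl⟩
  exact this

/-! Lyapunov functions -/

section Lyapunov

variable {E : Type*} [NormedAddCommGroup E] [NormedSpace ℝ E]
  {v : E → E} {S : Set E} {V Ψ : E → ℝ}

/-- Along solutions of `q' = v q` in the set `S`, the function `V` decreases with rate
at least `Ψ`. -/
structure IsDissipatedOn (v : E → E) (S : Set E) (V Ψ : E → ℝ) : Prop where
  continuous_V : Continuous V
  continuous_rate : Continuous Ψ
  nonneg : ∀ y, 0 ≤ Ψ y
  upperDeriv : ∀ (q : ℝ → E) (t b : ℝ), t < b → IsSolutionOn v (Icc t b) q →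
    (∀ s ∈ Icc t b, q s ∈ S) → HasUpperDerivAt (fun s => V (q s)) (-Ψ (q t)) t

lemma IsDissipatedOn.le_sub (h : IsDissipatedOn v S V Ψ) {q : ℝ → E} {s t c : ℝ} (hst : s ≤ t)
    (hq : IsSolutionOn v (Icc s t) q) (hS : ∀ x ∈ Icc s t, q x ∈ S)
    (hc : ∀ x ∈ Icc s t, c ≤ Ψ (q x)) : V (q t) ≤ V (q s) - c * (t - s) := by
  refine le_sub_of_hasUpperDerivAt (f := fun x => V (q x)) (b := fun x => -Ψ (q x)) hst
    (h.continuous_V.comp_continuousOn hq.continuousOn) (fun x hx => ?_)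
    fun x hx => neg_le_neg (hc x ⟨hx.1, hx.2.le⟩)
  exact h.upperDeriv q x t hx.2 (hq.mono (Icc_subset_Icc_left hx.1))
    fun y hy => hS y ⟨hx.1.trans hy.1, hy.2⟩

lemma IsDissipatedOn.antitone (h : IsDissipatedOn v S V Ψ) {q : ℝ → E} {s t : ℝ} (hst : s ≤ t)
    (hq : IsSolutionOn v (Icc s t) q) (hS : ∀ x ∈ Icc s t, q x ∈ S) : V (q t) ≤ V (q s) := by
  simpa using h.le_sub (c := 0) hst hq hS fun x _ => h.nonneg _

/-- Along a solution that stays in a compact set, the dissipation rate tends to zero. -/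
lemma IsDissipatedOn.tendsto_rate (h : IsDissipatedOn v S V Ψ) {q : ℝ → E} {K : Set E}
    (hK : IsCompact K) {M : ℝ} (hM : ∀ y ∈ K, y ∈ S → ‖v y‖ ≤ M)
    (hq : IsSolutionOn v (Ici 0) q) (hqK : ∀ t, 0 ≤ t → q t ∈ K) (hqS : ∀ t, 0 ≤ t → q t ∈ S) :
    Tendsto (fun t => Ψ (q t)) atTop (𝓝 0) := by
  have hsub : ∀ {s t : ℝ}, 0 ≤ s → Icc s t ⊆ Ici 0 := fun hs x hx => hs.trans hx.1
  have hmono : ∀ {s t : ℝ}, 0 ≤ s → s ≤ t → V (q t) ≤ V (q s) := fun hs hst =>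
    h.antitone hst (hq.mono (hsub hs)) fun x hx => hqS x (hsub hs hx)
  obtain ⟨m, hm⟩ := hK.exists_bound_of_continuousOn h.continuous_V.continuousOn
  have hM0 : 0 ≤ M := (norm_nonneg _).trans (hM _ (hqK 0 le_rfl) (hqS 0 le_rfl))
  have hlip : ∀ {s t : ℝ}, 0 ≤ s → s ≤ t → dist (q t) (q s) ≤ M * (t - s) := fun {s t} hs hst => by
    have := (convex_Icc s t).norm_image_sub_le_of_norm_hasDerivWithin_le (C := M)
      (fun x hx => hq.mono (hsub hs) x hx)
      (fun x hx => hM _ (hqK x (hsub hs hx)) (hqS x (hsub hs hx))) (left_mem_Icc.2 hst)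
      (right_mem_Icc.2 hst)
    rwa [← dist_eq_norm, Real.norm_of_nonneg (sub_nonneg.2 hst)] at this
  have huc := hK.uniformContinuousOn_of_continuous h.continuous_rate.continuousOn
  rw [Metric.uniformContinuousOn_iff] at huc
  by_contra hcon
  rw [Metric.tendsto_atTop] at hcon
  push Not at hcon
  obtain ⟨ε, hε, hcon⟩ := hcon
  obtain ⟨δ, hδ, huc⟩ := huc (ε / 2) (by positivity)
  -- The solution has speed at most `M`, so within time `τ` it moves by less than `δ`: once the rate
  -- reaches `ε` it stays above `ε / 2` for this long. The `+ 1` covers `M = 0`.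
  set τ := δ / (2 * (M + 1)) with hτ
  have hτ0 : 0 < τ := by positivity
  have hMτ : M * τ < δ := by
    have : (M + 1) * τ = δ / 2 := by rw [hτ]; field_simp
    nlinarith
  have hdrop : ∀ t, 0 ≤ t → ε ≤ Ψ (q t) → V (q (t + τ)) ≤ V (q t) - ε / 2 * τ := by
    intro t ht hψ
    have := h.le_sub (c := ε / 2) (le_add_of_nonneg_right hτ0.le) (hq.mono (hsub ht))
      (fun x hx => hqS x (hsub ht hx)) (fun x hx => ?_)
    · simpa using this
    · have h1 : dist (q x) (q t) < δ := by
        refine (hlip ht hx.1).trans_lt (lt_of_le_of_lt ?_ hMτ)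
        have := hx.2
        gcongr
        linarith
      have h2 := huc _ (hqK x (hsub ht hx)) _ (hqK t ht) h1
      rw [Real.dist_eq, abs_lt] at h2
      linarith [h2.1]
  -- Each recurrence of a rate above `ε` costs a fixed amount of `V`; infinitely many contradict the
  -- lower bound of `V` on `K`.
  have hiter : ∀ k : ℕ, ∃ t, 0 ≤ t ∧ V (q t) ≤ V (q 0) - k * (ε / 2 * τ) := by
    intro k
    induction k with
    | zero => exact ⟨0, le_rfl, by simp⟩
    | succ k ih =>
      obtain ⟨t, ht, hVt⟩ := ih
      obtain ⟨t', htt', hψ⟩ := hcon t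
      rw [dist_zero_right, Real.norm_of_nonneg (h.nonneg _)] at hψ
      have ht' := ht.trans htt'
      refine ⟨t' + τ, by linarith, (hdrop t' ht' hψ).trans ?_⟩
      have := hmono ht htt'
      push_cast
      linarith
  obtain ⟨k, hk⟩ := exists_nat_gt ((V (q 0) + m) / (ε / 2 * τ))
  rw [div_lt_iff₀ (by positivity)] at hk
  obtain ⟨t, ht, hVt⟩ := hiter k
  have := hm _ (hqK t ht)
  rw [Real.norm_eq_abs, abs_le] at this
  linarith [this.1]

/-- LaSalle's principle: solutions in a compact set approach the set where the
dissipation rate vanishes. -/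
lemma IsDissipatedOn.tendsto_infEDist (h : IsDissipatedOn v S V Ψ) {q : ℝ → E} {K : Set E}
    (hK : IsCompact K) {M : ℝ} (hM : ∀ y ∈ K, y ∈ S → ‖v y‖ ≤ M)
    (hS : IsClosed S) (hq : IsSolutionOn v (Ici 0) q) (hqK : ∀ t, 0 ≤ t → q t ∈ K)
    (hqS : ∀ t, 0 ≤ t → q t ∈ S) {F : Type*} [PseudoEMetricSpace F] {G : E → F} (hG : Continuous G)
    {A : Set F} (hA : ∀ y ∈ K, y ∈ S → Ψ y = 0 → G y ∈ A) :
    Tendsto (fun t => Metric.infEDist (G (q t)) A) atTop (𝓝 0) := by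
  have hlim := h.tendsto_rate hK hM hq hqK hqS
  rw [ENNReal.tendsto_nhds_zero]
  intro ε hε
  have hcl : IsClosed {y | ε ≤ Metric.infEDist (G y) A} :=
    isClosed_le continuous_const (Metric.continuous_infEDist.comp hG)
  -- On the states at distance at least `ε` from the target the rate has a positive minimum, by
  -- compactness, and the solution eventually stays below it. With `A` empty every distance is
  -- infinite and the argument is unchanged.
  have hc : IsCompact (K ∩ (S ∩ {y | ε ≤ Metric.infEDist (G y) A})) :=
    hK.inter_right (hS.inter hcl)
  rcases (K ∩ (S ∩ {y | ε ≤ Metric.infEDist (G y) A})).eq_empty_or_nonempty with he | hne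
  · filter_upwards [eventually_ge_atTop 0] with t ht
    by_contra hcon
    exact eq_empty_iff_forall_notMem.1 he (q t) ⟨hqK t ht, hqS t ht, (not_le.1 hcon).le⟩
  · obtain ⟨y, ⟨hyK, hyS, hy⟩, hmin⟩ := hc.exists_isMinOn hne h.continuous_rate.continuousOn
    have hpos : 0 < Ψ y := by
      refine lt_of_le_of_ne (h.nonneg y) fun h0 => ?_
      have hy : ε ≤ Metric.infEDist (G y) A := hy
      rw [Metric.infEDist_zero_of_mem (hA y hyK hyS h0.symm)] at hy
      exact absurd hy (not_le.2 hε)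
    filter_upwards [eventually_ge_atTop 0, hlim.eventually_lt_const hpos] with t ht ht'
    by_contra hcon
    exact absurd (hmin ⟨hqK t ht, hqS t ht, (not_le.1 hcon).le⟩) (not_le.2 ht')

/-- Lyapunov's stability theorem relative to an invariant closed set. -/
lemma IsDissipatedOn.isLocallyAsymptoticallyStableOn [ProperSpace E] (h : IsDissipatedOn v S V Ψ)
    (hS : IsClosed S) {e : E} (heS : e ∈ S) (he : v e = 0)
    (hinv : ∀ (T : EReal) (q : ℝ → E), IsSolutionOn v (timeInterval T) q → q 0 ∈ S →
      ∀ t ∈ timeInterval T, q t ∈ S)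
    (hbdd : ∀ R, ∃ M, ∀ y ∈ Metric.closedBall e R, y ∈ S → ‖v y‖ ≤ M)
    {ρ : ℝ} (hρ : 0 < ρ) (hV : ∀ y ∈ Metric.closedBall e ρ, y ∈ S → y ≠ e → V e < V y)
    (hΨ : ∀ y ∈ Metric.closedBall e ρ, y ∈ S → Ψ y = 0 → y = e) :
    IsLocallyAsymptoticallyStableOn v S e := by
  have hstab : ∀ ε > (0 : ℝ), ∃ δ > (0 : ℝ), ∀ (T : EReal) (q : ℝ → E),
      IsSolutionOn v (timeInterval T) q → q 0 ∈ S → dist (q 0) e < δ →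
      ∀ t ∈ timeInterval T, dist (q t) e < ε := by
    intro ε hε
    set r := min ε ρ with hr
    have hr0 : 0 < r := lt_min hε hρ
    -- A solution starting below the level `V e + η` cannot reach the sphere, and by the
    -- intermediate value theorem it cannot get past it otherwise.
    obtain ⟨η, hη, hηV⟩ : ∃ η > 0, ∀ y ∈ Metric.sphere e r, y ∈ S → V e + η ≤ V y := by
      have hc : IsCompact (Metric.sphere e r ∩ S) := (isCompact_sphere e r).inter_right hS
      rcases (Metric.sphere e r ∩ S).eq_empty_or_nonempty with hem | hne
      · exact ⟨1, one_pos, fun y hy hyS => absurd hem (Nonempty.ne_empty ⟨y, hy, hyS⟩)⟩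
      · obtain ⟨y, ⟨hy, hyS⟩, hmin⟩ := hc.exists_isMinOn hne h.continuous_V.continuousOn
        have hy' : dist y e = r := hy
        refine ⟨V y - V e, sub_pos.2 (hV y ?_ hyS ?_), fun z hz hzS => ?_⟩
        · exact hy'.le.trans (min_le_right _ _)
        · rintro rfl; rw [dist_self] at hy'; linarith
        · have : V y ≤ V z := hmin ⟨hz, hzS⟩
          linarith
    obtain ⟨δ, hδ, hδV⟩ := Metric.continuous_iff.1 h.continuous_V e η hη
    refine ⟨min δ r, lt_min hδ hr0, fun T q hq hq0 hd t ht => ?_⟩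
    by_contra hcon
    have hcont : ContinuousOn (fun s => dist (q s) e) (Icc 0 t) :=
      (continuous_id.dist continuous_const).comp_continuousOn
        (hq.mono (Icc_subset_timeInterval ht)).continuousOn
    obtain ⟨s, hs, hsr⟩ := intermediate_value_Icc ht.1 hcont
      (show r ∈ Icc _ _ from ⟨(hd.trans_le (min_le_right _ _)).le,
        (min_le_left _ _).trans (not_lt.1 hcon)⟩)
    have hs' := Icc_subset_timeInterval ht hs
    have h1 := hηV (q s) hsr (hinv T q hq hq0 s hs')
    have h2 := h.antitone hs.1 (hq.mono (Icc_subset_timeInterval hs'))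
      fun x hx => hinv T q hq hq0 x (Icc_subset_timeInterval hs' hx)
    have h3 := hδV (q 0) (hd.trans_le (min_le_left _ _))
    rw [Real.dist_eq, abs_lt] at h3
    linarith [h3.2]
  refine ⟨heS, he, hinv, hstab, ?_⟩
  obtain ⟨δ, hδ, hstab⟩ := hstab ρ hρ
  refine ⟨δ, hδ, fun q hq hq0 hd => ?_⟩
  have hq' := hq
  rw [timeInterval_top] at hq'
  have htop : ∀ {t : ℝ}, 0 ≤ t → t ∈ timeInterval ⊤ := fun ht => by rwa [timeInterval_top]
  obtain ⟨M, hM⟩ := hbdd ρ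
  have := h.tendsto_infEDist (isCompact_closedBall e ρ) hM hS hq'
    (fun t ht => (hstab ⊤ q hq hq0 hd t (htop ht)).le)
    (fun t ht => hinv ⊤ q hq hq0 t (htop ht)) continuous_id (A := {e})
    (fun y hy hyS hy0 => hΨ y hy hyS hy0)
  simp only [Metric.infEDist_singleton, id] at this
  exact tendsto_iff_edist_tendsto_0.2 this

end Lyapunov

/-! A converse Lyapunov theorem for uniformly globally exponentially stable plants -/

/-- At a zero of the curve the norm has a corner, but slopes to the right are positive multiples, so
the one-sided derivative exists. It makes Lipschitz error terms that vanish at the base time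
admissible in majorants. -/
lemma HasDerivWithinAt.norm_of_eq_zero {E : Type*} [NormedAddCommGroup E] [NormedSpace ℝ E]
    {f : ℝ → E} {f' : E} {t : ℝ} (hf : HasDerivWithinAt f f' (Ici t) t) (h0 : f t = 0) :
    HasDerivWithinAt (fun s => ‖f s‖) ‖f'‖ (Ici t) t := by
  rw [hasDerivWithinAt_iff_tendsto_slope, Ici_sdiff_left] at hf ⊢
  refine hf.norm.congr' ?_
  filter_upwards [self_mem_nhdsWithin] with s hs
  have : 0 < s - t := sub_pos.2 hs
  rw [slope_def_module, slope_def_module, h0]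
  simp [norm_smul, abs_of_pos this]

/-- `W` is a Lyapunov function for the plant `x' = p x u` with steady states `h u`:
it is comparable to `‖x - h u‖`, decays exponentially for constant inputs, and depends on the input
in a Lipschitz way. -/
structure IsPlantLyapunov {E U : Type*} [NormedAddCommGroup E] [NormedSpace ℝ E]
    [NormedAddCommGroup U] [NormedSpace ℝ U] (p : E → U → E) (h : U → E) (W : E → U → ℝ)
    (k r C : ℝ) : Prop where
  norm_le : ∀ x u, ‖x - h u‖ ≤ W x u
  le_norm : ∀ x u, W x u ≤ k * ‖x - h u‖
  lipschitz : ∀ x x' u u', |W x u - W x' u'| ≤ C * (‖x - x'‖ + ‖u - u'‖)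
  upperDeriv : ∀ (x : ℝ → E) (u : ℝ → U) (u' : U) (t : ℝ),
    HasDerivWithinAt x (p (x t) (u t)) (Ici t) t → HasDerivWithinAt u u' (Ici t) t →
      HasUpperDerivAt (fun s => W (x s) (u s)) (-r * W (x t) (u t) + C * ‖u'‖) t

lemma IsSolutionOn.Icc_of_timeInterval_top {E : Type*} [NormedAddCommGroup E] [NormedSpace ℝ E]
    {v : E → E} {q : ℝ → E} (hq : IsSolutionOn v (timeInterval ⊤) q) (T : ℝ) :
    IsSolutionOn v (Icc 0 T) q :=
  hq.mono fun t ht => by rw [timeInterval_top]; exact ht.1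

/-- `W x u` is the supremum over `0 ≤ t ≤ T` of `exp (r t)` times the distance to `h u` along the
solution with frozen input `u`. The finite horizon keeps Grönwall constants finite, hence `W`
Lipschitz. It loses nothing: after `T` the weighted distance is below its initial value, so `W` also
dominates all later times, which gives decay along the frozen flow. -/
theorem UniformlyGloballyExponentiallyStable.exists_isPlantLyapunov {E U : Type*}
    [NormedAddCommGroup E] [NormedSpace ℝ E] [ProperSpace E] [NormedAddCommGroup U]
    [NormedSpace ℝ U] {p : E → U → E} {h : U → E} (hst : UniformlyGloballyExponentiallyStable p h)
    {L Lh : ℝ} (hL : 0 < L) (hLh : 0 < Lh)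
    (hpx : ∀ x x' u, ‖p x u - p x' u‖ ≤ L * ‖x - x'‖)
    (hpu : ∀ x u u', ‖p x u - p x u'‖ ≤ L * ‖u - u'‖)
    (hh : ∀ u u', ‖h u - h u'‖ ≤ Lh * ‖u - u'‖) :
    ∃ W : E → U → ℝ, ∃ k > 0, ∃ r > 0, ∃ C > 0, IsPlantLyapunov p h W k r C := by
  obtain ⟨heq, k, hk, r₀, hr₀, hdecay⟩ := hst
  -- The other half of the rate makes the weighted distance decay like `k * exp (-r t)`, so it falls
  -- below its initial value by the time `T = k / r`, since `k ≤ exp (r * T)`.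
  set r := r₀ / 2 with hr
  have hr0 : 0 < r := by positivity
  have hlip : ∀ u, LipschitzWith L.toNNReal (fun x => p x u) := fun u =>
    LipschitzWith.of_dist_le_mul fun x x' => by
      rw [Real.coe_toNNReal _ hL.le, dist_eq_norm, dist_eq_norm]; exact hpx x x' u
  choose X hX hX0 using fun (x : E) (u : U) => (hlip u).exists_isSolutionOn_timeInterval_top x
  set T := k / r with hT
  have hT0 : 0 < T := by positivity
  let w : E → U → ℝ → ℝ := fun x u t => Real.exp (r * t) * ‖X x u t - h u‖
  have hw : ∀ x u t, 0 ≤ t → w x u t ≤ k * Real.exp (-r * t) * ‖x - h u‖ := by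
    intro x u t ht
    have := hdecay u (X x u) (hX x u) t ht
    rw [hX0] at this
    calc w x u t ≤ Real.exp (r * t) * (k * Real.exp (-r₀ * t) * ‖x - h u‖) := by
          simp only [w]; gcongr
      _ = k * (Real.exp (r * t) * Real.exp (-r₀ * t)) * ‖x - h u‖ := by ring
      _ = _ := by rw [← Real.exp_add]; congr 3; rw [hr]; ring
  have hwk : ∀ x u t, 0 ≤ t → w x u t ≤ k * ‖x - h u‖ := fun x u t ht => by
    refine (hw x u t ht).trans ?_
    have : Real.exp (-r * t) ≤ 1 := Real.exp_le_one_iff.2 (by nlinarith)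
    have := mul_le_mul_of_nonneg_left this hk.le
    rw [mul_one] at this
    gcongr
  have : Nonempty (Icc 0 T) := ⟨⟨0, le_rfl, hT0.le⟩⟩
  have hbdd : ∀ x u, BddAbove (range fun t : Icc 0 T => w x u t) := fun x u =>
    ⟨k * ‖x - h u‖, by rintro _ ⟨t, rfl⟩; exact hwk x u t t.2.1⟩
  let W : E → U → ℝ := fun x u => ⨆ t : Icc 0 T, w x u t
  have hnorm : ∀ x u, ‖x - h u‖ ≤ W x u := fun x u => by
    have := le_ciSup (hbdd x u) ⟨0, le_rfl, hT0.le⟩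
    simpa [w, hX0] using this
  have hwW : ∀ x u t, 0 ≤ t → w x u t ≤ W x u := by
    intro x u t ht
    rcases le_total t T with h1 | h1
    · exact le_ciSup (hbdd x u) ⟨t, ht, h1⟩
    · refine (hw x u t ht).trans (le_trans ?_ (hnorm x u))
      have h2 : k ≤ Real.exp (r * t) := by
        have : k ≤ r * t := by
          have : r * T = k := by rw [hT]; field_simp
          nlinarith
        linarith [Real.add_one_le_exp (r * t)]
      have h3 : k * Real.exp (-r * t) ≤ 1 := by
        calc k * Real.exp (-r * t) ≤ Real.exp (r * t) * Real.exp (-r * t) := by gcongr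
          _ = 1 := by rw [← Real.exp_add]; simp
      exact mul_le_of_le_one_left (norm_nonneg _) h3
  have hdec : ∀ x u τ, 0 ≤ τ → W (X x u τ) u ≤ Real.exp (-r * τ) * W x u := by
    intro x u τ hτ
    refine ciSup_le fun t => ?_
    -- The flow property, from uniqueness for the frozen input.
    have h1 : X (X x u τ) u t = X x u (τ + t) := by
      refine IsSolutionOn.eqOn (hlip u).locallyLipschitz
        ((hX (X x u τ) u).Icc_of_timeInterval_top t)
        (((hX x u).Icc_of_timeInterval_top (τ + t)).shift hτ) ?_ ⟨t.2.1, le_rfl⟩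
      simp [hX0]
    have h2 := hwW x u (τ + t) (add_nonneg hτ t.2.1)
    calc w (X x u τ) u t = Real.exp (-r * τ) * w x u (τ + t) := by
          simp only [w]
          rw [h1, ← mul_assoc, ← Real.exp_add]
          congr 2; ring
      _ ≤ _ := by gcongr
  -- The largest weight, times the Grönwall growth of solutions in initial value and input plus the
  -- Lipschitz constant of `h`.
  set C := Real.exp (r * T) * (Real.exp (L * T) + Lh) with hC
  have hC0 : 0 < C := by positivity
  have hdep : ∀ x x' u u' t, t ∈ Icc 0 T →
      ‖X x u t - X x' u' t‖ ≤ (‖x - x'‖ + ‖u - u'‖) * Real.exp (L * T) := by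
    intro x x' u u' t ht
    have h1 := (hX x u).Icc_of_timeInterval_top T
    have h2 := (hX x' u').Icc_of_timeInterval_top T
    have := dist_le_of_approx_trajectories_ODE (v := fun _ x => p x u) (δ := ‖x - x'‖) (εf := 0)
      (εg := L * ‖u - u'‖) (fun _ => hlip u) h1.continuousOn
      (fun t ht => h1.hasDerivWithinAt_Ici ht) (fun t _ => by simp) h2.continuousOn
      (fun t ht => h2.hasDerivWithinAt_Ici ht)
      (fun t _ => by rw [dist_comm, dist_eq_norm]; exact hpu _ _ _)
      (by rw [hX0, hX0, dist_eq_norm]) t ht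
    rw [← dist_eq_norm]
    refine this.trans ?_
    rw [Real.coe_toNNReal _ hL.le, gronwallBound_of_K_ne_0 hL.ne']
    have h3 : Real.exp (L * (t - 0)) ≤ Real.exp (L * T) := by
      rw [sub_zero]
      exact Real.exp_le_exp.2 (mul_le_mul_of_nonneg_left ht.2 hL.le)
    have h4 : (0 + L * ‖u - u'‖) / L = ‖u - u'‖ := by field_simp; ring
    rw [h4]
    nlinarith [norm_nonneg (x - x'), norm_nonneg (u - u')]
  have hone : ∀ x x' u u', W x u ≤ W x' u' + C * (‖x - x'‖ + ‖u - u'‖) := by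
    intro x x' u u'
    refine ciSup_le fun t => ?_
    have h1 := hwW x' u' t t.2.1
    have h2 : ‖X x u t - h u‖ ≤ ‖X x' u' t - h u'‖ +
        (Real.exp (L * T) + Lh) * (‖x - x'‖ + ‖u - u'‖) := by
      calc ‖X x u t - h u‖
          = ‖(X x' u' t - h u') + ((X x u t - X x' u' t) - (h u - h u'))‖ := by congr 1; abel
        _ ≤ ‖X x' u' t - h u'‖ + (‖X x u t - X x' u' t‖ + ‖h u - h u'‖) :=
            (norm_add_le _ _).trans (by gcongr; exact norm_sub_le _ _)
        _ ≤ _ := by nlinarith [hdep x x' u u' t t.2, hh u u', norm_nonneg (x - x')]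
    have h3 : Real.exp (r * t) ≤ Real.exp (r * T) :=
      Real.exp_le_exp.2 (mul_le_mul_of_nonneg_left t.2.2 hr0.le)
    calc w x u t ≤ Real.exp (r * t) * (‖X x' u' t - h u'‖ +
        (Real.exp (L * T) + Lh) * (‖x - x'‖ + ‖u - u'‖)) := by simp only [w]; gcongr
      _ = w x' u' t + Real.exp (r * t) * ((Real.exp (L * T) + Lh) * (‖x - x'‖ + ‖u - u'‖)) := by
        simp only [w]; ring
      _ ≤ W x' u' + Real.exp (r * T) * ((Real.exp (L * T) + Lh) * (‖x - x'‖ + ‖u - u'‖)) := by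
        gcongr
      _ = _ := by rw [hC]; ring
  refine ⟨W, k, hk, r, hr0, C, hC0, hnorm, fun x u => ciSup_le fun t => hwk x u t t.2.1,
    fun x x' u u' => ?_, fun x u u' t hx hu => ?_⟩
  · rw [abs_le]
    have h1 := hone x x' u u'
    have h2 := hone x' x u' u
    rw [norm_sub_rev x' x, norm_sub_rev u' u] at h2
    constructor <;> linarith
  -- The actual curve is compared with the frozen solution issuing from `(x t, u t)`. Both have the
  -- same velocity at time `t`, so to first order only the motion of the input contributes to the
  -- Lipschitz error.
  · set y := X (x t) (u t) with hy
    have hy' : HasDerivWithinAt (fun s => y (s - t)) (p (x t) (u t)) (Ici t) t := by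
      have h0 : HasDerivWithinAt y (p (x t) (u t)) (Ici 0) (t - t) := by
        have h3 := hX (x t) (u t) 0 (by rw [timeInterval_top]; exact self_mem_Ici)
        rw [hX0, timeInterval_top] at h3
        rwa [sub_self]
      have h1 : HasDerivWithinAt (fun s : ℝ => s - t) 1 (Ici t) t := by
        simpa using ((hasDerivAt_id t).sub_const t).hasDerivWithinAt
      have h2 := HasDerivWithinAt.scomp (h := fun s => s - t) t h0 h1
        (fun s (hs : t ≤ s) => show 0 ≤ s - t from sub_nonneg.2 hs)
      simpa [Function.comp_def] using h2
    have hd1 := (hx.sub hy').norm_of_eq_zero (by simp [hy, hX0])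
    have hd2 := (hu.sub_const (u t)).norm_of_eq_zero (by simp)
    have hd3 : HasDerivWithinAt (fun s => Real.exp (-r * (s - t)) * W (x t) (u t))
        (-r * W (x t) (u t)) (Ici t) t := by
      have := ((((hasDerivAt_id t).sub_const t).const_mul (-r)).exp.mul_const
        (W (x t) (u t))).hasDerivWithinAt (s := Ici t)
      simpa using this
    refine ⟨_, (hd3.add ((hd1.add hd2).const_mul C)).congr_deriv ?_, ?_, ?_⟩
    · simp
    · simp [hy, hX0]
    · filter_upwards [self_mem_nhdsWithin] with s hs
      have hs : t < s := hs
      have h1 := hone (x s) (y (s - t)) (u s) (u t)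
      have h2 := hdec (x t) (u t) (s - t) (sub_nonneg.2 hs.le)
      simp only [Pi.add_apply, Pi.sub_apply]
      linarith

/-! An interconnection estimate -/

/-- Two numbers `x, y` with `s * t ≥ k²` satisfy `2 k x y ≤ s x² + t y²`. -/
lemma two_mul_mul_le_of_sq_le_mul {k s t : ℝ} (hs : 0 < s) (h : k ^ 2 ≤ s * t) (x y : ℝ) :
    2 * k * x * y ≤ s * x ^ 2 + t * y ^ 2 := by
  have h1 : 0 ≤ s * (s * x ^ 2 + t * y ^ 2 - 2 * k * x * y) := by
    nlinarith [sq_nonneg (s * x - k * y), mul_nonneg (sub_nonneg.2 h) (sq_nonneg y)]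
  linarith [nonneg_of_mul_nonneg_right h1 hs]

/-- The quadratic form that bounds the derivative of the composite Lyapunov function is negative
definite for small gains and suitable weights `a`, `b`, `c`. -/
lemma exists_composite_weights {C r l : ℝ} (hC : 0 < C) (hr : 0 < r) (hl : 0 < l) :
    ∃ A₁ > 0, ∃ A₂ > 0, ∀ α₁ ∈ Ioo 0 A₁, ∀ α₂ ∈ Ioo 0 A₂,
      ∃ a > 0, ∃ b > 0, ∃ c > 0, ∃ η > 0, ∀ D X Y Z : ℝ,
        -α₁ * D ^ 2 + α₁ * (C * (D * (X + Y + Z)))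
          + a * (2 * X * (-r * X + C * (α₁ * (D + X + Y + Z))))
          + b * (2 * Y * (-(α₁ / α₂) * l * Y + C * X))
          + c * (2 * Z * (-(α₁ / α₂) * l * Z + C * (X + α₁ / α₂ * Y)))
          ≤ -(η * (D ^ 2 + X ^ 2 + Y ^ 2 + Z ^ 2)) := by
  -- The order of choice matters: `γ` makes the `Z²` term dominate, `β` then also absorbs the `Y Z`
  -- coupling weighted by `γ`, and a small `ρ` makes cross terms with the plant error, quadratic in
  -- `ρ` after squaring, smaller than `ρ * r`.
  set γ := (2 * C ^ 2 + 3) / l with hγ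
  set β := (2 * C ^ 2 + 3 + γ * C ^ 2 / l) / l with hβ
  set ρ := r / (72 * C ^ 2) with hρ
  have hγ0 : 0 < γ := by positivity
  have hβ0 : 0 < β := by positivity
  have hρ0 : 0 < ρ := by positivity
  have hγl : γ * l = 2 * C ^ 2 + 3 := by rw [hγ]; field_simp
  have hβl : β * l = 2 * C ^ 2 + 3 + γ * C ^ 2 / l := by rw [hβ]; field_simp
  have hρC : ρ * (72 * C ^ 2) = r := by rw [hρ]; field_simp
  clear_value γ β ρ
  refine ⟨min ρ (r / (8 * C)), by positivity,
    min 1 (ρ * r / (8 * C ^ 2 * (β ^ 2 + γ ^ 2))), by positivity,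
    fun α₁ hα₁ α₂ hα₂ => ?_⟩
  obtain ⟨h1, h1'⟩ := hα₁
  obtain ⟨h2, h2'⟩ := hα₂
  have hαρ : α₁ ≤ ρ := h1'.le.trans (min_le_left _ _)
  have hαr : α₁ * (8 * C) ≤ r := by
    have := h1'.le.trans (min_le_right _ _)
    rwa [le_div_iff₀ (by positivity)] at this
  have hα2 : 8 * C ^ 2 * (β ^ 2 + γ ^ 2) * α₂ ^ 2 ≤ ρ * r := by
    have h3 := h2'.le.trans (min_le_left _ _)
    have h4 := h2'.le.trans (min_le_right _ _)
    rw [le_div_iff₀ (by positivity)] at h4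
    have h5 : α₂ ^ 2 ≤ α₂ := pow_le_of_le_one h2.le h3 two_ne_zero
    calc 8 * C ^ 2 * (β ^ 2 + γ ^ 2) * α₂ ^ 2 ≤ 8 * C ^ 2 * (β ^ 2 + γ ^ 2) * α₂ := by gcongr
      _ ≤ _ := by linarith
  have hρr : 0 < ρ * r := by positivity
  -- These weights, together with the rescaling `X = α₁ x`, turn the whole form into `α₁` times one
  -- in which small gains occur only in terms to be absorbed.
  refine ⟨ρ / α₁, by positivity, β * α₂, by positivity, γ * α₂, by positivity,
    min (α₁ / 2) (ρ * r / (2 * α₁)), by positivity, fun D X Y Z => ?_⟩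
  obtain ⟨x, rfl⟩ : ∃ x, X = α₁ * x := ⟨X / α₁, by field_simp⟩
  have e1 := two_mul_mul_le_of_sq_le_mul (k := C / 2) (s := 1 / 8) (t := 2 * C ^ 2) (by norm_num)
    (le_of_eq (by ring)) D Y
  have e2 := two_mul_mul_le_of_sq_le_mul (k := C / 2) (s := 1 / 8) (t := 2 * C ^ 2) (by norm_num)
    (le_of_eq (by ring)) D Z
  -- As `α₁ ≤ ρ`, the coefficient is at most `3 ρ C`; the 72 in `ρ` makes `(3 ρ C / 2)²` equal to `1
  -- / 8 * (ρ r / 4)`.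
  have e3 := two_mul_mul_le_of_sq_le_mul (k := (C * α₁ + 2 * ρ * C) / 2) (s := 1 / 8)
    (t := ρ * r / 4) (by norm_num) (by
      rw [← hρC]
      have : C * α₁ + 2 * ρ * C ≤ 3 * ρ * C := by
        linarith [mul_le_mul_of_nonneg_left hαρ hC.le]
      have h0 : 0 ≤ C * α₁ + 2 * ρ * C := by positivity
      have := pow_le_pow_left₀ h0 this 2
      linarith) D x
  have e4 : 2 * ρ * C * α₁ * x ^ 2 ≤ ρ * r / 4 * x ^ 2 := by
    have : 2 * ρ * C * α₁ ≤ ρ * r / 4 := by linarith [mul_le_mul_of_nonneg_left hαr hρ0.le]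
    gcongr
  have hcross : (ρ * C) ^ 2 ≤ ρ * r / 4 * 1 := by
    rw [← hρC]; linarith [sq_nonneg (ρ * C)]
  have e5 := two_mul_mul_le_of_sq_le_mul (k := ρ * C) (s := ρ * r / 4) (t := 1) (by positivity)
    hcross x Y
  have e6 := two_mul_mul_le_of_sq_le_mul (k := ρ * C) (s := ρ * r / 4) (t := 1) (by positivity)
    hcross x Z
  have hp1 : 0 ≤ C ^ 2 * β ^ 2 * α₂ ^ 2 := by positivity
  have hp2 : 0 ≤ C ^ 2 * γ ^ 2 * α₂ ^ 2 := by positivity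
  have e7 := two_mul_mul_le_of_sq_le_mul (k := β * α₂ * C) (s := ρ * r / 8) (t := 1)
    (by positivity) (by linarith) x Y
  have e8 := two_mul_mul_le_of_sq_le_mul (k := γ * α₂ * C) (s := ρ * r / 8) (t := 1)
    (by positivity) (by linarith) x Z
  have e9 := two_mul_mul_le_of_sq_le_mul (k := γ * C) (s := γ * l) (t := γ * C ^ 2 / l)
    (by positivity) (le_of_eq (by field_simp)) Z Y
  have hfac : -α₁ * D ^ 2 + α₁ * (C * (D * (α₁ * x + Y + Z)))
      + ρ / α₁ * (2 * (α₁ * x) * (-r * (α₁ * x) + C * (α₁ * (D + α₁ * x + Y + Z))))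
      + β * α₂ * (2 * Y * (-(α₁ / α₂) * l * Y + C * (α₁ * x)))
      + γ * α₂ * (2 * Z * (-(α₁ / α₂) * l * Z + C * (α₁ * x + α₁ / α₂ * Y)))
      = α₁ * (-D ^ 2 + 2 * (C / 2) * D * Y + 2 * (C / 2) * D * Z
        + 2 * ((C * α₁ + 2 * ρ * C) / 2) * D * x - 2 * (ρ * r) * x ^ 2 + 2 * ρ * C * α₁ * x ^ 2
        + 2 * (ρ * C) * x * Y + 2 * (ρ * C) * x * Z + 2 * (β * α₂ * C) * x * Y
        + 2 * (γ * α₂ * C) * x * Z + 2 * (γ * C) * Z * Y - 2 * (β * l) * Y ^ 2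
        - 2 * (γ * l) * Z ^ 2) := by
    field_simp
    ring
  have hle : -D ^ 2 + 2 * (C / 2) * D * Y + 2 * (C / 2) * D * Z
        + 2 * ((C * α₁ + 2 * ρ * C) / 2) * D * x - 2 * (ρ * r) * x ^ 2 + 2 * ρ * C * α₁ * x ^ 2
        + 2 * (ρ * C) * x * Y + 2 * (ρ * C) * x * Z + 2 * (β * α₂ * C) * x * Y
        + 2 * (γ * α₂ * C) * x * Z + 2 * (γ * C) * Z * Y - 2 * (β * l) * Y ^ 2
        - 2 * (γ * l) * Z ^ 2 ≤ -(1 / 2 * D ^ 2 + ρ * r / 2 * x ^ 2 + 1 / 2 * Y ^ 2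
          + 1 / 2 * Z ^ 2) := by
    have hY : 0 ≤ γ * C ^ 2 / l * Y ^ 2 := by positivity
    have hCY : 0 ≤ C ^ 2 * Y ^ 2 := by positivity
    rw [hγl, hβl]
    rw [hγl] at e9
    linarith [sq_nonneg D, mul_nonneg hρr.le (sq_nonneg x), sq_nonneg Y, sq_nonneg Z]
  rw [hfac]
  have m1 := min_le_left (α₁ / 2) (ρ * r / (2 * α₁))
  have m2 := min_le_right (α₁ / 2) (ρ * r / (2 * α₁))
  have m3 : min (α₁ / 2) (ρ * r / (2 * α₁)) * (α₁ * x) ^ 2 ≤ α₁ * (ρ * r / 2 * x ^ 2) := by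
    calc _ ≤ ρ * r / (2 * α₁) * (α₁ * x) ^ 2 := by gcongr
      _ = _ := by field_simp
  have m4 : min (α₁ / 2) (ρ * r / (2 * α₁)) * (D ^ 2 + Y ^ 2 + Z ^ 2)
      ≤ α₁ / 2 * (D ^ 2 + Y ^ 2 + Z ^ 2) := by gcongr
  have := mul_le_mul_of_nonneg_left hle h1.le
  linarith

/-! Block vectors -/

section Blocks

variable {N : ℕ}

lemma norm_toLp_norm {β : Fin N → Type*} [∀ i, SeminormedAddCommGroup (β i)] (a : PiLp 2 β) :
    ‖(WithLp.toLp 2 fun i => ‖a i‖ : EuclideanSpace ℝ (Fin N))‖ = ‖a‖ := by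
  rw [PiLp.norm_eq_of_L2, PiLp.norm_eq_of_L2]
  simp

/-- The bound is monotonicity and the triangle inequality in `ℝ^N` for the vectors of block norms;
it transfers the agentwise Lipschitz estimates to the stacked maps. -/
lemma PiLp.norm_le_of_forall_norm_le {β β₁ β₂ : Fin N → Type*}
    [∀ i, SeminormedAddCommGroup (β i)] [∀ i, SeminormedAddCommGroup (β₁ i)]
    [∀ i, SeminormedAddCommGroup (β₂ i)] {a : PiLp 2 β} {b : PiLp 2 β₁} {c : PiLp 2 β₂}
    {s t : ℝ} (hs : 0 ≤ s) (ht : 0 ≤ t) (h : ∀ i, ‖a i‖ ≤ s * ‖b i‖ + t * ‖c i‖) :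
    ‖a‖ ≤ s * ‖b‖ + t * ‖c‖ := by
  have h1 : ‖a‖ ≤ ‖s • (WithLp.toLp 2 fun i => ‖b i‖ : EuclideanSpace ℝ (Fin N))
      + t • (WithLp.toLp 2 fun i => ‖c i‖ : EuclideanSpace ℝ (Fin N))‖ := by
    rw [PiLp.norm_eq_of_L2, PiLp.norm_eq_of_L2]
    refine Real.sqrt_le_sqrt (Finset.sum_le_sum fun i _ => ?_)
    refine pow_le_pow_left₀ (norm_nonneg _) ((h i).trans ?_) 2
    exact le_abs_self _
  refine h1.trans ((norm_add_le _ _).trans (le_of_eq ?_))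
  rw [norm_smul, norm_smul, norm_toLp_norm, norm_toLp_norm, Real.norm_of_nonneg hs,
    Real.norm_of_nonneg ht]

lemma PiLp.norm_le_mul_of_forall_norm_le {β β₁ : Fin N → Type*}
    [∀ i, SeminormedAddCommGroup (β i)] [∀ i, SeminormedAddCommGroup (β₁ i)]
    {a : PiLp 2 β} {b : PiLp 2 β₁} {s : ℝ} (hs : 0 ≤ s) (h : ∀ i, ‖a i‖ ≤ s * ‖b i‖) :
    ‖a‖ ≤ s * ‖b‖ := by
  simpa using PiLp.norm_le_of_forall_norm_le (c := b) hs le_rfl (fun i => by simpa using h i)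

variable (N) (d : ℕ)

/-- The block vector all of whose blocks are `c`. -/
def constBlocks : EuclideanSpace ℝ (Fin d) →L[ℝ] Stack N (fun _ => d) :=
  LinearMap.toContinuousLinearMap
    { toFun := fun c => WithLp.toLp 2 fun _ => c
      map_add' := fun _ _ => rfl
      map_smul' := fun _ _ => rfl }

/-- The average of the blocks. -/
def blockAverage : Stack N (fun _ => d) →L[ℝ] EuclideanSpace ℝ (Fin d) :=
  LinearMap.toContinuousLinearMap
    { toFun := fun y => (1 / (N : ℝ)) • ∑ i, y i
      map_add' := fun _ _ => by simp [Finset.sum_add_distrib, smul_add]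
      map_smul' := fun c _ => by simp only [PiLp.smul_apply, ← Finset.smul_sum, RingHom.id_apply,
        smul_comm c] }

/-- The deviation of the blocks from their average. -/
def blockDeviation : Stack N (fun _ => d) →L[ℝ] Stack N (fun _ => d) :=
  .id ℝ _ - (constBlocks N d).comp (blockAverage N d)

variable {N d}

@[simp] lemma constBlocks_apply (c : EuclideanSpace ℝ (Fin d)) (i : Fin N) :
    constBlocks N d c i = c := rfl

lemma blockAverage_apply (y : Stack N (fun _ => d)) :
    blockAverage N d y = (1 / (N : ℝ)) • ∑ i, y i := rfl

lemma blockDeviation_apply (y : Stack N (fun _ => d)) :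
    blockDeviation N d y = y - constBlocks N d (blockAverage N d y) := rfl

lemma blockAverage_constBlocks (hN : 0 < N) (c : EuclideanSpace ℝ (Fin d)) :
    blockAverage N d (constBlocks N d c) = c := by
  have : (N : ℝ) ≠ 0 := by positivity
  simp [blockAverage_apply, ← Nat.cast_smul_eq_nsmul ℝ, smul_smul, this]

lemma sum_blockDeviation (hN : 0 < N) (y : Stack N (fun _ => d)) :
    ∑ i, blockDeviation N d y i = 0 := by
  have : (N : ℝ) ≠ 0 := by positivity
  simp [blockDeviation_apply, blockAverage_apply, ← Nat.cast_smul_eq_nsmul ℝ, smul_smul, this]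

lemma blockDeviation_eq_self {y : Stack N (fun _ => d)} (hy : ∑ i, y i = 0) :
    blockDeviation N d y = y := by
  simp [blockDeviation_apply, blockAverage_apply, hy]

lemma blockDeviation_constBlocks (hN : 0 < N) (c : EuclideanSpace ℝ (Fin d)) :
    blockDeviation N d (constBlocks N d c) = 0 := by
  simp [blockDeviation_apply, blockAverage_constBlocks hN]

end Blocks

/-! The Laplacian of a weight-balanced digraph -/

namespace AgentNetwork

variable {N : ℕ} {n m : Fin N → ℕ} {d : ℕ} (P : AgentNetwork N n m d)

/-- The Laplacian of the communication digraph, acting on block vectors. -/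
def laplacian : Stack N (fun _ => d) →L[ℝ] Stack N (fun _ => d) :=
  LinearMap.toContinuousLinearMap
    { toFun := fun y => WithLp.toLp 2 fun i => ∑ j ∈ P.inNeighbors i, P.weight i j • (y i - y j)
      map_add' := fun x y => by
        ext1 i
        simp only [PiLp.add_apply, ← Finset.sum_add_distrib, ← smul_add]
        exact Finset.sum_congr rfl fun j _ => by congr 1; abel
      map_smul' := fun c y => by
        ext1 i
        simp only [PiLp.smul_apply, RingHom.id_apply, Finset.smul_sum]
        exact Finset.sum_congr rfl fun j _ => by rw [← smul_sub, smul_comm c] }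

lemma weight_nonneg (i j : Fin N) : 0 ≤ P.weight i j := by
  by_cases h : P.graph.Adj j i
  · exact (P.weight_pos i j h).le
  · exact (P.weight_zero i j h).ge

lemma sum_inNeighbors {F : Type*} [AddCommMonoid F] [Module ℝ F] (i : Fin N) (y : Fin N → F) :
    ∑ j ∈ P.inNeighbors i, P.weight i j • y j = ∑ j, P.weight i j • y j := by
  refine Finset.sum_subset (Finset.subset_univ _) fun j _ hj => ?_
  rw [P.weight_zero i j (by simpa [inNeighbors] using hj), zero_smul]

lemma sum_weight_inNeighbors (i : Fin N) :
    ∑ j ∈ P.inNeighbors i, P.weight i j = ∑ j, P.weight i j := by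
  simpa using P.sum_inNeighbors i (fun _ => (1 : ℝ))

lemma sum_weight_outNeighbors (i : Fin N) :
    ∑ j ∈ P.outNeighbors i, P.weight j i = ∑ j, P.weight j i := by
  refine Finset.sum_subset (Finset.subset_univ _) fun j _ hj => ?_
  rw [P.weight_zero j i (by simpa [outNeighbors] using hj)]

lemma laplacian_apply (y : Stack N (fun _ => d)) (i : Fin N) :
    P.laplacian y i = ∑ j, P.weight i j • (y i - y j) :=
  P.sum_inNeighbors i (fun j => y i - y j)

lemma laplacian_constBlocks (c : EuclideanSpace ℝ (Fin d)) :
    P.laplacian (constBlocks N d c) = 0 := by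
  ext1 i
  simp [laplacian_apply]

lemma laplacian_blockDeviation (y : Stack N (fun _ => d)) :
    P.laplacian (blockDeviation N d y) = P.laplacian y := by
  rw [blockDeviation_apply, map_sub, laplacian_constBlocks, sub_zero]

variable {P}

lemma GraphAssumption.sum_weight (h3 : P.GraphAssumption) (i : Fin N) :
    ∑ j, P.weight i j = ∑ j, P.weight j i := by
  rw [← sum_weight_inNeighbors, ← sum_weight_outNeighbors, h3.weight_balanced]

lemma GraphAssumption.sum_laplacian (h3 : P.GraphAssumption) (y : Stack N (fun _ => d)) :
    ∑ i, P.laplacian y i = 0 := by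
  simp only [laplacian_apply, smul_sub, Finset.sum_sub_distrib, ← Finset.sum_smul]
  rw [Finset.sum_comm (f := fun i j => P.weight i j • y j)]
  simp only [← Finset.sum_smul, h3.sum_weight, sub_self]

lemma GraphAssumption.blockDeviation_laplacian (h3 : P.GraphAssumption)
    (y : Stack N (fun _ => d)) : blockDeviation N d (P.laplacian y) = P.laplacian y :=
  blockDeviation_eq_self (h3.sum_laplacian y)

/-- Expanding the squares leaves row sums and column sums of the weights against `‖y i‖ ^ 2`; weight
balance makes them cancel, although the graph is directed. -/
lemma GraphAssumption.inner_laplacian (h3 : P.GraphAssumption) (y : Stack N (fun _ => d)) :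
    2 * ⟪y, P.laplacian y⟫_ℝ = ∑ i, ∑ j, P.weight i j * ‖y i - y j‖ ^ 2 := by
  have h1 : ∀ i j, P.weight i j * ‖y i - y j‖ ^ 2 = 2 * (P.weight i j * ⟪y i, y i - y j⟫_ℝ)
      - P.weight i j * ‖y i‖ ^ 2 + P.weight i j * ‖y j‖ ^ 2 := fun i j => by
    rw [norm_sub_sq_real, inner_sub_right, real_inner_self_eq_norm_sq]; ring
  have h2 : ∑ i, ∑ j, P.weight i j * ‖y j‖ ^ 2 = ∑ i, ∑ j, P.weight i j * ‖y i‖ ^ 2 := by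
    rw [Finset.sum_comm]
    refine Finset.sum_congr rfl fun j _ => ?_
    rw [← Finset.sum_mul, ← Finset.sum_mul, h3.sum_weight]
  simp only [h1, Finset.sum_add_distrib, Finset.sum_sub_distrib, h2, sub_add_cancel,
    ← Finset.mul_sum]
  simp [PiLp.inner_apply, laplacian_apply, inner_sum, inner_smul_right]

lemma GraphAssumption.eq_of_inner_laplacian_eq_zero (h3 : P.GraphAssumption)
    {y : Stack N (fun _ => d)} (hy : ⟪y, P.laplacian y⟫_ℝ = 0) (i j : Fin N) : y i = y j := by
  have h0 := h3.inner_laplacian y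
  rw [hy, mul_zero] at h0
  have hnn : ∀ i j, 0 ≤ P.weight i j * ‖y i - y j‖ ^ 2 := fun i j =>
    mul_nonneg (P.weight_nonneg i j) (sq_nonneg _)
  have hstep : ∀ i j, P.graph.Adj i j → y i = y j := fun i j hij => by
    have h1 := (Finset.sum_eq_zero_iff_of_nonneg
      (fun i _ => Finset.sum_nonneg fun j _ => hnn i j)).1 h0.symm j (Finset.mem_univ _)
    have h2 := (Finset.sum_eq_zero_iff_of_nonneg (fun i _ => hnn j i)).1 h1 i (Finset.mem_univ _)
    rcases mul_eq_zero.1 h2 with h | h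
    · exact absurd h (P.weight_pos j i hij).ne'
    · exact (sub_eq_zero.1 (norm_eq_zero.1 (pow_eq_zero_iff two_ne_zero |>.1 h))).symm
  have := h3.strongly_connected i j
  induction this with
  | refl => rfl
  | tail _ h ih => exact ih.trans (hstep _ _ h)

/-- The Laplacian is positive definite on deviations from the average. -/
lemma GraphAssumption.exists_le_inner_laplacian (h3 : P.GraphAssumption) (hN : 0 < N) :
    ∃ l > 0, ∀ y : Stack N (fun _ => d), ∑ i, y i = 0 → l * ‖y‖ ^ 2 ≤ ⟪y, P.laplacian y⟫_ℝ := by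
  have hcont : Continuous fun y : Stack N (fun _ => d) => ⟪y, P.laplacian y⟫_ℝ :=
    continuous_id.inner P.laplacian.continuous
  have hclosed : IsClosed {y : Stack N (fun _ => d) | ∑ i, y i = 0} :=
    isClosed_eq (by fun_prop) continuous_const
  have hnonneg : ∀ y : Stack N (fun _ => d), 0 ≤ ⟪y, P.laplacian y⟫_ℝ := fun y => by
    have h : 0 ≤ 2 * ⟪y, P.laplacian y⟫_ℝ := by
      rw [h3.inner_laplacian]
      exact Finset.sum_nonneg fun i _ => Finset.sum_nonneg fun j _ =>
        mul_nonneg (P.weight_nonneg i j) (sq_nonneg _)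
    linarith
  -- The minimum over unit zero-sum vectors is attained; were it zero, strong connectivity would
  -- make the minimizer constant, hence zero. Homogeneity then gives all zero-sum vectors.
  obtain ⟨l, hl, hmin⟩ : ∃ l > 0, ∀ y ∈ Metric.sphere (0 : Stack N (fun _ => d)) 1,
      ∑ i, y i = 0 → l ≤ ⟪y, P.laplacian y⟫_ℝ := by
    have hc := (isCompact_sphere (0 : Stack N (fun _ => d)) 1).inter_right hclosed
    rcases (Metric.sphere (0 : Stack N (fun _ => d)) 1 ∩ {y | ∑ i, y i = 0}).eq_empty_or_nonempty
      with he | hne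
    · exact ⟨1, one_pos, fun y hy hy0 => absurd he (Nonempty.ne_empty ⟨y, hy, hy0⟩)⟩
    · obtain ⟨y, ⟨hy, hy0⟩, hmin⟩ := hc.exists_isMinOn hne hcont.continuousOn
      refine ⟨_, lt_of_le_of_ne (hnonneg y) fun h0 => ?_, fun z hz hz0 => hmin ⟨hz, hz0⟩⟩
      have hconst := h3.eq_of_inner_laplacian_eq_zero h0.symm
      have hy00 : y = 0 := by
        ext1 i
        have h1 : (N : ℝ) • y i = 0 := by
          have hy0 : ∑ j, y j = 0 := hy0
          rw [Finset.sum_congr rfl fun j _ => hconst j i] at hy0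
          simpa [← Nat.cast_smul_eq_nsmul ℝ, -smul_eq_zero] using hy0
        exact (smul_eq_zero.1 h1).resolve_left (by positivity)
      rw [hy00] at hy
      simp at hy
  refine ⟨l, hl, fun y hy => ?_⟩
  rcases eq_or_ne y 0 with rfl | hy0
  · simp
  have hn : 0 < ‖y‖ := norm_pos_iff.2 hy0
  have h1 := hmin (‖y‖⁻¹ • y) (by simp [norm_smul, hn.ne'])
    (by simp [← Finset.smul_sum, hy])
  rw [map_smul, inner_smul_left, inner_smul_right] at h1
  simp only [conj_trivial] at h1
  calc l * ‖y‖ ^ 2 ≤ (‖y‖⁻¹ * (‖y‖⁻¹ * ⟪y, P.laplacian y⟫_ℝ)) * ‖y‖ ^ 2 := by gcongr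
    _ = _ := by field_simp

end AgentNetwork

/-! Calculus with the stacked maps of the network -/

lemma sqrt_add_sq_le_add {a b : ℝ} (ha : 0 ≤ a) (hb : 0 ≤ b) : √(a ^ 2 + b ^ 2) ≤ a + b :=
  Real.sqrt_le_iff.2 ⟨by positivity, by nlinarith⟩

lemma continuous_uncurry_of_norm_sub_le {E F G : Type*} [NormedAddCommGroup E]
    [NormedAddCommGroup F] [NormedAddCommGroup G] {f : E → F → G} {L : ℝ} (hL : 0 < L)
    (h : ∀ x x' y y', ‖f x y - f x' y'‖ ≤ L * √(‖x - x'‖ ^ 2 + ‖y - y'‖ ^ 2)) :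
    Continuous fun r : E × F => f r.1 r.2 := by
  refine (LipschitzWith.of_dist_le_mul (K := (2 * L).toNNReal) fun r r' => ?_).continuous
  rw [Real.coe_toNNReal _ (by positivity), dist_eq_norm, dist_eq_norm]
  have h1 := norm_fst_le (r - r')
  have h2 := norm_snd_le (r - r')
  have h3 := sqrt_add_sq_le_add (norm_nonneg (r.1 - r'.1)) (norm_nonneg (r.2 - r'.2))
  rw [Prod.fst_sub] at h1
  rw [Prod.snd_sub] at h2
  calc _ ≤ L * √(‖r.1 - r'.1‖ ^ 2 + ‖r.2 - r'.2‖ ^ 2) := h _ _ _ _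
    _ ≤ L * (‖r - r'‖ + ‖r - r'‖) := by gcongr; linarith
    _ = _ := by ring

lemma norm_fderiv_le_of_norm_sub_le {E F : Type*} [NormedAddCommGroup E] [NormedSpace ℝ E]
    [NormedAddCommGroup F] [NormedSpace ℝ F] {f : E → F} {L : ℝ} (hL : 0 < L)
    (h : ∀ x x', ‖f x - f x'‖ ≤ L * ‖x - x'‖) (x : E) : ‖fderiv ℝ f x‖ ≤ L :=
  norm_fderiv_le_of_lip' ℝ hL.le (Eventually.of_forall fun y => h y x)

namespace AgentNetwork

variable {N : ℕ} {n m : Fin N → ℕ} {d : ℕ} (P : AgentNetwork N n m d)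

/-- The stacked plant dynamics. -/
def plant (x : Stack N n) (u : Stack N m) : Stack N n := WithLp.toLp 2 fun i => P.p i (x i) (u i)

/-- The stacked contributions `φ_i(x_i)`. -/
def contribution (x : Stack N n) : Stack N (fun _ => d) := WithLp.toLp 2 fun i => P.φ i (x i)

/-- The stacked gradients `∇₂f_i(x_i, s_i)`. -/
def grad2Stack (x : Stack N n) (s : Stack N (fun _ => d)) : Stack N (fun _ => d) :=
  WithLp.toLp 2 fun i => P.grad2 i (x i) (s i)

/-- The stacked directions `∇₁f_i(x_i, s_i) + ∇φ_i(x_i) g_i`. -/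
def direction (x : Stack N n) (s g : Stack N (fun _ => d)) : Stack N n :=
  WithLp.toLp 2 fun i => P.grad1 i (x i) (s i) + P.gradφ i (x i) (g i)

/-- The transposed Jacobian of the stacked steady-state map. -/
def gradSteady (u : Stack N m) (v : Stack N n) : Stack N m :=
  WithLp.toLp 2 fun i => P.gradh i (u i) (v i)

/-- The estimates `s_i` of the aggregative variable. -/
def aggEstimate (q : ClosedLoopState N n m d) : Stack N (fun _ => d) :=
  q.2.1 + P.contribution q.1.1

/-- The estimates `g_i` of the average gradient in the second argument. -/
def gradEstimate (q : ClosedLoopState N n m d) : Stack N (fun _ => d) :=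
  q.2.2 + P.grad2Stack q.1.1 (P.aggEstimate q)

lemma closedLoop_eq (α₁ α₂ : ℝ) (q : ClosedLoopState N n m d) : P.closedLoop α₁ α₂ q =
    ((P.plant q.1.1 q.1.2,
      -(α₁ • P.gradSteady q.1.2 (P.direction q.1.1 (P.aggEstimate q) (P.gradEstimate q)))),
     (-((α₁ / α₂) • P.laplacian (P.aggEstimate q)),
      -((α₁ / α₂) • P.laplacian (P.gradEstimate q)))) := by
  refine Prod.ext (Prod.ext rfl rfl) (Prod.ext rfl ?_)
  ext1 i
  change -((α₁ / α₂) • ∑ j ∈ P.inNeighbors i, P.weight i j • P.gradEstimate q i)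
      + (α₁ / α₂) • ∑ j ∈ P.inNeighbors i, P.weight i j • P.gradEstimate q j
    = -((α₁ / α₂) • ∑ j ∈ P.inNeighbors i, P.weight i j •
        (P.gradEstimate q i - P.gradEstimate q j))
  simp only [smul_sub, Finset.sum_sub_distrib]
  abel

lemma sigma_eq_blockAverage (x : Stack N n) :
    P.sigma x = blockAverage N d (P.contribution x) := rfl

lemma piw_eq (x : Stack N n) : P.piw x = -blockDeviation N d (P.contribution x) := by
  ext1 i
  rw [blockDeviation_apply, ← sigma_eq_blockAverage]
  simp [piw, contribution]
  abel

lemma piz_eq (x : Stack N n) :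
    P.piz x = -blockDeviation N d (P.grad2Stack x (constBlocks N d (P.sigma x))) := by
  ext1 i
  rw [blockDeviation_apply, blockAverage_apply]
  simp [piz, grad2Stack]
  abel

section

variable {P}

lemma SteadyStateAssumption.plant_steady (h1 : P.SteadyStateAssumption) (u : Stack N m) :
    P.plant (P.steady u) u = 0 := by
  ext1 i
  exact (h1.stable i).1 (u i)

/-- With finitely many agents, the largest gain and the smallest rate serve for the stacked plant.
-/
lemma SteadyStateAssumption.stable_plant (hN : 0 < N) (h1 : P.SteadyStateAssumption) :
    UniformlyGloballyExponentiallyStable P.plant P.steady := by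
  refine ⟨h1.plant_steady, ?_⟩
  choose k hk r hr hdecay using fun i => (h1.stable i).2
  have : Nonempty (Fin N) := ⟨⟨0, hN⟩⟩
  have hne : (Finset.univ : Finset (Fin N)).Nonempty := Finset.univ_nonempty
  have hk' : ∀ i, k i ≤ Finset.univ.sup' hne k := fun i => Finset.le_sup' k (Finset.mem_univ i)
  have hr' : ∀ i, Finset.univ.inf' hne r ≤ r i := fun i => Finset.inf'_le r (Finset.mem_univ i)
  have hk0 := (hk ⟨0, hN⟩).trans_le (hk' _)
  refine ⟨Finset.univ.sup' hne k, hk0, Finset.univ.inf' hne r,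
    (Finset.lt_inf'_iff _).2 fun i _ => hr i, fun u q hq t ht => ?_⟩
  refine PiLp.norm_le_mul_of_forall_norm_le (by positivity) fun i => ?_
  have hqi : IsSolutionOn (fun x => P.p i x (u i)) (timeInterval ⊤) fun t => q t i := fun s hs =>
    ((PiLp.proj 2 (𝕜 := ℝ) (fun i : Fin N => EuclideanSpace ℝ (Fin (n i))) i).hasFDerivAt.comp_hasDerivWithinAt
      s (hq s hs))
  refine (hdecay i (u i) _ hqi t ht).trans ?_
  change _ ≤ _ * ‖q 0 i - P.h i (u i)‖
  gcongr
  · exact hk' i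
  · exact hr' i

lemma SteadyStateAssumption.exists_norm_plant_sub_le (h1 : P.SteadyStateAssumption) :
    ∃ L > 0, (∀ x x' u, ‖P.plant x u - P.plant x' u‖ ≤ L * ‖x - x'‖) ∧
      (∀ x u u', ‖P.plant x u - P.plant x u'‖ ≤ L * ‖u - u'‖) := by
  obtain ⟨L, hL, h⟩ := h1.lipschitz_p
  exact ⟨L, hL, fun x x' u => PiLp.norm_le_mul_of_forall_norm_le hL.le fun i => (h i).1 _ _ _,
    fun x u u' => PiLp.norm_le_mul_of_forall_norm_le hL.le fun i => (h i).2 _ _ _⟩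

lemma SteadyStateAssumption.exists_norm_steady_sub_le (h1 : P.SteadyStateAssumption) :
    ∃ L > 0, ∀ u u', ‖P.steady u - P.steady u'‖ ≤ L * ‖u - u'‖ := by
  obtain ⟨L, hL, h⟩ := h1.lipschitz_h
  exact ⟨L, hL, fun u u' => PiLp.norm_le_mul_of_forall_norm_le hL.le fun i => h i _ _⟩

lemma SteadyStateAssumption.exists_norm_gradSteady_le (h1 : P.SteadyStateAssumption) :
    ∃ L > 0, ∀ u v, ‖P.gradSteady u v‖ ≤ L * ‖v‖ := by
  obtain ⟨L, hL, h⟩ := h1.lipschitz_h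
  refine ⟨L, hL, fun u v => PiLp.norm_le_mul_of_forall_norm_le hL.le fun i => ?_⟩
  refine (ContinuousLinearMap.le_opNorm _ _).trans ?_
  gcongr
  rw [gradh, LinearIsometryEquiv.norm_map]
  exact norm_fderiv_le_of_norm_sub_le hL (h i) _

lemma SteadyStateAssumption.continuous_gradSteady (h1 : P.SteadyStateAssumption) :
    Continuous fun r : Stack N m × Stack N n => P.gradSteady r.1 r.2 := by
  refine (PiLp.continuous_toLp 2 _).comp (continuous_pi fun i => ?_)
  have hc : Continuous (P.gradh i) :=
    (LinearIsometryEquiv.continuous _).comp ((h1.smooth i).continuous_fderiv one_ne_zero)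
  exact (hc.comp (by fun_prop : Continuous fun r : Stack N m × Stack N n => r.1 i)).clm_apply
    (by fun_prop)

lemma gradSteady_sub (u : Stack N m) (v v' : Stack N n) :
    P.gradSteady u (v - v') = P.gradSteady u v - P.gradSteady u v' := by
  ext1 i
  simp [gradSteady]

lemma SteadyStateAssumption.hasFDerivAt_steady (h1 : P.SteadyStateAssumption) (u : Stack N m) :
    ∃ D : Stack N m →L[ℝ] Stack N n, HasFDerivAt P.steady D u ∧
      ∀ v w, ⟪v, D w⟫_ℝ = ⟪P.gradSteady u v, w⟫_ℝ := by
  have hd : ∀ i, HasFDerivAt (fun u : Stack N m => P.steady u i)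
      ((fderiv ℝ (P.h i) (u i)).comp
        (PiLp.proj 2 (𝕜 := ℝ) (fun i : Fin N => EuclideanSpace ℝ (Fin (m i))) i)) u := fun i =>
    (((h1.smooth i).differentiable one_ne_zero (u i)).hasFDerivAt.comp u
      (PiLp.proj 2 (𝕜 := ℝ) (fun i : Fin N => EuclideanSpace ℝ (Fin (m i))) i).hasFDerivAt)
  have hdiff : DifferentiableAt ℝ P.steady u :=
    (differentiableAt_piLp 2).2 fun i => (hd i).differentiableAt
  refine ⟨fderiv ℝ P.steady u, hdiff.hasFDerivAt, fun v w => ?_⟩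
  rw [PiLp.inner_apply, PiLp.inner_apply]
  refine Finset.sum_congr rfl fun i _ => ?_
  have h := ((PiLp.proj 2 (𝕜 := ℝ) (fun i : Fin N => EuclideanSpace ℝ (Fin (n i))) i).hasFDerivAt.comp
    u hdiff.hasFDerivAt).unique (hd i)
  have h2 := DFunLike.congr_fun h w
  have h3 : fderiv ℝ P.steady u w i = fderiv ℝ (P.h i) (u i) (w i) := h2
  rw [h3]
  exact (ContinuousLinearMap.adjoint_inner_left _ _ _).symm

lemma CostAssumption.continuous_grad1 (h2 : P.CostAssumption) (i : Fin N) :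
    Continuous fun r : EuclideanSpace ℝ (Fin (n i)) × EuclideanSpace ℝ (Fin d) =>
      P.grad1 i r.1 r.2 := by
  obtain ⟨L, hL, h⟩ := h2.lipschitz1
  exact continuous_uncurry_of_norm_sub_le hL (h i)

lemma CostAssumption.continuous_grad2 (h2 : P.CostAssumption) (i : Fin N) :
    Continuous fun r : EuclideanSpace ℝ (Fin (n i)) × EuclideanSpace ℝ (Fin d) =>
      P.grad2 i r.1 r.2 := by
  obtain ⟨L, hL, h⟩ := h2.lipschitz2
  exact continuous_uncurry_of_norm_sub_le hL (h i)

/-- Only partial differentiability is assumed; the Lipschitz bounds make the partial gradients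
jointly continuous, which yields the joint derivative. -/
lemma CostAssumption.hasFDerivAt_cost (h2 : P.CostAssumption) (i : Fin N)
    (r : EuclideanSpace ℝ (Fin (n i)) × EuclideanSpace ℝ (Fin d)) :
    HasFDerivAt (fun r : EuclideanSpace ℝ (Fin (n i)) × EuclideanSpace ℝ (Fin d) =>
      P.f i r.1 r.2) ((InnerProductSpace.toDual ℝ _ (P.grad1 i r.1 r.2)).coprod
        (InnerProductSpace.toDual ℝ _ (P.grad2 i r.1 r.2))) r :=
  (hasStrictFDerivAt_uncurry_coprod (f := P.f i)
    (f₁ := fun x y => InnerProductSpace.toDual ℝ _ (P.grad1 i x y))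
    (f₂ := fun x y => InnerProductSpace.toDual ℝ _ (P.grad2 i x y))
    (Eventually.of_forall fun v => (h2.differentiable1 i v.2 v.1).hasGradientAt.hasFDerivAt)
    (Eventually.of_forall fun v => (h2.differentiable2 i v.1 v.2).hasGradientAt.hasFDerivAt)
    ((LinearIsometryEquiv.continuous _).comp (h2.continuous_grad1 i)).continuousAt
    ((LinearIsometryEquiv.continuous _).comp (h2.continuous_grad2 i)).continuousAt).hasFDerivAt

lemma CostAssumption.differentiable_contribution (h2 : P.CostAssumption) :
    Differentiable ℝ P.contribution := fun x =>
  (differentiableAt_piLp 2).2 fun i => (h2.differentiable_φ i (x i)).comp x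
    (PiLp.proj 2 (𝕜 := ℝ) (fun i : Fin N => EuclideanSpace ℝ (Fin (n i))) i).differentiableAt

lemma CostAssumption.fderiv_contribution_apply (h2 : P.CostAssumption) (x v : Stack N n)
    (i : Fin N) : fderiv ℝ P.contribution x v i = fderiv ℝ (P.φ i) (x i) (v i) := by
  have hd : HasFDerivAt (fun x : Stack N n => P.contribution x i)
      ((fderiv ℝ (P.φ i) (x i)).comp
        (PiLp.proj 2 (𝕜 := ℝ) (fun i : Fin N => EuclideanSpace ℝ (Fin (n i))) i)) x :=
    ((h2.differentiable_φ i (x i)).hasFDerivAt.comp x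
      (PiLp.proj 2 (𝕜 := ℝ) (fun i : Fin N => EuclideanSpace ℝ (Fin (n i))) i).hasFDerivAt)
  exact DFunLike.congr_fun
    (((PiLp.proj 2 (𝕜 := ℝ) (fun _ : Fin N => EuclideanSpace ℝ (Fin d)) i).hasFDerivAt.comp
      x (h2.differentiable_contribution x).hasFDerivAt).unique hd) v

lemma CostAssumption.exists_norm_contribution_sub_le (h2 : P.CostAssumption) :
    ∃ L > 0, ∀ x x', ‖P.contribution x - P.contribution x'‖ ≤ L * ‖x - x'‖ := by
  obtain ⟨L, hL, h⟩ := h2.lipschitz_φ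
  exact ⟨L, hL, fun x x' => PiLp.norm_le_mul_of_forall_norm_le hL.le fun i => h i _ _⟩

lemma CostAssumption.exists_norm_grad2Stack_sub_le (h2 : P.CostAssumption) :
    ∃ L > 0, ∀ x x' s s',
      ‖P.grad2Stack x s - P.grad2Stack x' s'‖ ≤ L * (‖x - x'‖ + ‖s - s'‖) := by
  obtain ⟨L, hL, h⟩ := h2.lipschitz2
  refine ⟨L, hL, fun x x' s s' => ?_⟩
  rw [mul_add]
  refine PiLp.norm_le_of_forall_norm_le hL.le hL.le fun i => (h i _ _ _ _).trans ?_
  rw [← mul_add]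
  have := sqrt_add_sq_le_add (norm_nonneg (x i - x' i)) (norm_nonneg (s i - s' i))
  gcongr
  exact this

/-- The state `x` is the same on both sides because `∇φ_i` may be discontinuous in it; its norm is
bounded by the Lipschitz constant of `φ_i`. -/
lemma CostAssumption.exists_norm_direction_sub_le (h2 : P.CostAssumption) :
    ∃ L > 0, ∀ x s s' g g',
      ‖P.direction x s g - P.direction x s' g'‖ ≤ L * (‖s - s'‖ + ‖g - g'‖) := by
  obtain ⟨L, hL, h⟩ := h2.lipschitz1
  obtain ⟨L', hL', h'⟩ := h2.lipschitz_φ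
  refine ⟨L + L', by positivity, fun x s s' g g' => ?_⟩
  rw [mul_add]
  refine PiLp.norm_le_of_forall_norm_le (by positivity) (by positivity) fun i => ?_
  have h1 := h i (x i) (x i) (s i) (s' i)
  have h3 := sqrt_add_sq_le_add (norm_nonneg (x i - x i)) (norm_nonneg (s i - s' i))
  rw [sub_self, norm_zero, zero_add] at h3
  rw [sub_self, norm_zero] at h1
  have h4 : ‖P.gradφ i (x i) (g i - g' i)‖ ≤ L' * ‖g i - g' i‖ := by
    refine (ContinuousLinearMap.le_opNorm _ _).trans ?_
    gcongr
    rw [gradφ, LinearIsometryEquiv.norm_map]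
    exact norm_fderiv_le_of_norm_sub_le hL' (h' i) _
  calc ‖(P.direction x s g - P.direction x s' g') i‖
      = ‖(P.grad1 i (x i) (s i) - P.grad1 i (x i) (s' i)) + P.gradφ i (x i) (g i - g' i)‖ := by
        rw [map_sub]; congr 1; simp only [direction, PiLp.sub_apply]; abel
    _ ≤ L * ‖s i - s' i‖ + L' * ‖g i - g' i‖ := by
        refine (norm_add_le _ _).trans (add_le_add (h1.trans ?_) h4)
        gcongr
    _ ≤ _ := by
        have e1 : 0 ≤ L' * ‖(s - s') i‖ := by positivity
        have e2 : 0 ≤ L * ‖(g - g') i‖ := by positivity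
        simp only [PiLp.sub_apply] at e1 e2 ⊢
        linarith

/-- The gradient of the cost is the direction at the exact averages. -/
lemma CostAssumption.hasGradientAt_cost (h2 : P.CostAssumption) (x : Stack N n) :
    HasGradientAt P.cost (P.direction x (constBlocks N d (P.sigma x))
      (constBlocks N d (blockAverage N d (P.grad2Stack x (constBlocks N d (P.sigma x)))))) x := by
  set pr := fun i => PiLp.proj 2 (𝕜 := ℝ) (fun i : Fin N => EuclideanSpace ℝ (Fin (n i))) i
  have hσ : HasFDerivAt P.sigma ((blockAverage N d).comp (fderiv ℝ P.contribution x)) x :=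
    (blockAverage N d).hasFDerivAt.comp x (h2.differentiable_contribution x).hasFDerivAt
  have hd : HasFDerivAt P.cost (∑ i, ((InnerProductSpace.toDual ℝ _
      (P.grad1 i (x i) (P.sigma x))).coprod (InnerProductSpace.toDual ℝ _
        (P.grad2 i (x i) (P.sigma x)))).comp
          ((pr i).prod ((blockAverage N d).comp (fderiv ℝ P.contribution x)))) x := by
    refine HasFDerivAt.fun_sum fun i _ => ?_
    exact (h2.hasFDerivAt_cost i (x i, P.sigma x)).comp x ((pr i).hasFDerivAt.prodMk hσ)
  rw [hasGradientAt_iff_hasFDerivAt]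
  refine hd.congr_fderiv ?_
  ext v
  have h3 : ∀ i, ⟪P.gradφ i (x i) (blockAverage N d (P.grad2Stack x
      (constBlocks N d (P.sigma x)))), v i⟫_ℝ = ⟪blockAverage N d (P.grad2Stack x
      (constBlocks N d (P.sigma x))), fderiv ℝ P.contribution x v i⟫_ℝ := fun i => by
    rw [h2.fderiv_contribution_apply]
    exact ContinuousLinearMap.adjoint_inner_left _ _ _
  rw [InnerProductSpace.toDual_apply_apply, PiLp.inner_apply]
  simp only [_root_.sum_apply, ContinuousLinearMap.comp_apply,
    ContinuousLinearMap.prod_apply, ContinuousLinearMap.coprod_apply,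
    InnerProductSpace.toDual_apply_apply, direction, constBlocks_apply,
    inner_add_left, h3, Finset.sum_add_distrib]
  congr 1
  -- The factor `1 / N` of `σ` moves across the inner product: the derivative through `σ` pairs the
  -- summed gradients with the averaged variation, which equals their average paired with the summed
  -- variation.
  rw [← inner_sum, ← sum_inner, blockAverage_apply, blockAverage_apply, inner_smul_right,
    inner_smul_left]
  rfl

lemma CostAssumption.continuous_gradient_cost (h2 : P.CostAssumption) :
    Continuous (∇ P.cost) := by
  obtain ⟨L, hL, h⟩ := h2.lipschitz_cost
  exact (LipschitzWith.of_dist_le_mul (K := L.toNNReal) fun x x' => by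
    rw [Real.coe_toNNReal _ hL.le, dist_eq_norm, dist_eq_norm]; exact h x x').continuous

lemma CostAssumption.gradient_cost (h2 : P.CostAssumption) (x : Stack N n) :
    ∇ P.cost x = P.direction x (constBlocks N d (P.sigma x))
      (constBlocks N d (blockAverage N d (P.grad2Stack x (constBlocks N d (P.sigma x))))) :=
  (h2.hasGradientAt_cost x).gradient

lemma gradient_reducedCost (h1 : P.SteadyStateAssumption) (h2 : P.CostAssumption)
    (u : Stack N m) : ∇ P.reducedCost u = P.gradSteady u (∇ P.cost (P.steady u)) := by
  obtain ⟨D, hD, hDinner⟩ := h1.hasFDerivAt_steady u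
  have h := (h2.hasGradientAt_cost (P.steady u)).differentiableAt.hasGradientAt.hasFDerivAt.comp u hD
  refine HasGradientAt.gradient (hasGradientAt_iff_hasFDerivAt.2 (h.congr_fderiv ?_))
  ext w
  rw [ContinuousLinearMap.comp_apply, InnerProductSpace.toDual_apply_apply,
    InnerProductSpace.toDual_apply_apply, hDinner]

lemma continuous_gradient_reducedCost (h1 : P.SteadyStateAssumption) (h2 : P.CostAssumption) :
    Continuous (∇ P.reducedCost) := by
  obtain ⟨L', hL', h'⟩ := h1.exists_norm_steady_sub_le
  have hc := h2.continuous_gradient_cost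
  have hs : Continuous P.steady := (LipschitzWith.of_dist_le_mul (K := L'.toNNReal) fun x x' => by
    rw [Real.coe_toNNReal _ hL'.le, dist_eq_norm, dist_eq_norm]; exact h' x x').continuous
  have : ∇ P.reducedCost = fun u => P.gradSteady u (∇ P.cost (P.steady u)) :=
    funext fun u => gradient_reducedCost h1 h2 u
  rw [this]
  exact Continuous.comp (g := fun r : Stack N m × Stack N n => P.gradSteady r.1 r.2)
    (f := fun u => (u, ∇ P.cost (P.steady u))) h1.continuous_gradSteady
    (continuous_id.prodMk (hc.comp hs))

lemma mem_stationarySet (h1 : P.SteadyStateAssumption) (h2 : P.CostAssumption) {u : Stack N m}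
    (hu : ∇ P.reducedCost u = 0) : (P.steady u, u) ∈ P.stationarySet := by
  -- This multiplier cancels the derivative in `x`; the derivative in `u` that remains is the
  -- gradient of the reduced cost, which is zero.
  refine ⟨rfl, -∇ P.cost (P.steady u), ?_⟩
  obtain ⟨D, hD, hDinner⟩ := h1.hasFDerivAt_steady u
  have hc := (h2.hasGradientAt_cost (P.steady u)).differentiableAt.hasGradientAt.hasFDerivAt
  have hfst : HasFDerivAt (Prod.fst : Stack N n × Stack N m → Stack N n)
    (ContinuousLinearMap.fst ℝ _ _) (P.steady u, u) := hasFDerivAt_fst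
  have hsnd : HasFDerivAt (Prod.snd : Stack N n × Stack N m → Stack N m)
    (ContinuousLinearMap.snd ℝ _ _) (P.steady u, u) := hasFDerivAt_snd
  have h3 := (HasFDerivAt.comp (P.steady u, u) hc hfst).add
    ((innerSL ℝ (-∇ P.cost (P.steady u))).hasFDerivAt.comp (P.steady u, u)
      (hfst.sub (HasFDerivAt.comp (P.steady u, u) hD hsnd)))
  refine h3.congr_fderiv ?_
  have hz : ∀ w, ⟪∇ P.cost (P.steady u), D w⟫_ℝ = 0 := fun w => by
    rw [hDinner, ← gradient_reducedCost h1 h2, hu, inner_zero_left]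
  refine ContinuousLinearMap.ext fun r => ?_
  change ⟪∇ P.cost (P.steady u), r.1⟫_ℝ + ⟪-∇ P.cost (P.steady u), r.1 - D r.2⟫_ℝ = 0
  rw [inner_neg_left, inner_sub_right, hz]
  ring

end

end AgentNetwork

/-! Upper derivatives of squared norms -/

lemma HasUpperDerivAt.mono {f : ℝ → ℝ} {b c t : ℝ} (hf : HasUpperDerivAt f b t) (hbc : b ≤ c) :
    HasUpperDerivAt f c t := by
  obtain ⟨B, hB, hBt, hBf⟩ := hf
  have h1 : HasDerivWithinAt (fun s => (c - b) * (s - t)) (c - b) (Ici t) t := by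
    simpa using (((hasDerivAt_id t).sub_const t).const_mul (c - b)).hasDerivWithinAt (s := Ici t)
  refine ⟨fun s => B s + (c - b) * (s - t), (hB.add h1).congr_deriv (by ring), by simp [hBt], ?_⟩
  filter_upwards [hBf, self_mem_nhdsWithin] with s h2 h3
  have : 0 ≤ (c - b) * (s - t) := mul_nonneg (sub_nonneg.2 hbc) (sub_nonneg.2 (le_of_lt h3))
  linarith

/-- At a zero of `B` the product rule needs only continuity of `g`; it is applied with `g` a norm,
which need not be differentiable. -/
lemma HasDerivWithinAt.mul_of_eq_zero {g B : ℝ → ℝ} {β t : ℝ}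
    (hg : ContinuousWithinAt g (Ici t) t) (hB : HasDerivWithinAt B β (Ici t) t) (h0 : B t = 0) :
    HasDerivWithinAt (fun s => g s * B s) (g t * β) (Ici t) t := by
  rw [hasDerivWithinAt_iff_tendsto_slope] at hB ⊢
  refine ((hg.mono_left (nhdsWithin_mono _ sdiff_subset)).mul hB).congr fun s => ?_
  simp only [slope_def_module, h0, mul_zero, sub_zero, smul_eq_mul]
  ring

/-- The square of a function that is bounded by the norm of a differentiable curve and a
perturbation that vanishes at `t`. -/
lemma HasUpperDerivAt.sq_of_le_norm_add {F : Type*} [NormedAddCommGroup F]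
    [InnerProductSpace ℝ F] {y : ℝ → F} {y' : F} {f B : ℝ → ℝ} {β t : ℝ}
    (hy : HasDerivWithinAt y y' (Ici t) t) (hB : HasDerivWithinAt B β (Ici t) t) (hB0 : B t = 0)
    (hf0 : ∀ s, 0 ≤ f s) (hft : f t = ‖y t‖) (hf : ∀ s, f s ≤ ‖y s‖ + B s) :
    HasUpperDerivAt (fun s => f s ^ 2) (2 * ⟪y t, y'⟫_ℝ + 2 * (‖y t‖ * β)) t := by
  have h1 := HasDerivWithinAt.mul_of_eq_zero hy.continuousWithinAt.norm hB hB0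
  have h2 := HasDerivWithinAt.mul_of_eq_zero hB.continuousWithinAt hB hB0
  refine ⟨fun s => ‖y s‖ ^ 2 + 2 * (‖y s‖ * B s) + B s * B s,
    ((hy.norm_sq.add (h1.const_mul 2)).add h2).congr_deriv (by simp [hB0]), by simp [hB0, hft],
    Eventually.of_forall fun s => ?_⟩
  have := pow_le_pow_left₀ (hf0 s) (hf s) 2
  linarith

/-! ### Decay of the disagreements of the two estimators. -/

namespace AgentNetwork

variable {N : ℕ} {n m : Fin N → ℕ} {d : ℕ} (P : AgentNetwork N n m d)

/-- The disagreement of the estimates of the aggregative variable. -/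
def aggDisagreement (q : ClosedLoopState N n m d) : ℝ :=
  ‖blockDeviation N d (P.aggEstimate q)‖

/-- The disagreement of the estimates of the average gradient. -/
def gradDisagreement (q : ClosedLoopState N n m d) : ℝ :=
  ‖blockDeviation N d (P.gradEstimate q)‖

variable {P}

section Components

variable {q : ℝ → ClosedLoopState N n m d} {q' : ClosedLoopState N n m d} {J : Set ℝ} {t : ℝ}

lemma hasDerivWithinAt_x (hq : HasDerivWithinAt q q' J t) :
    HasDerivWithinAt (fun s => (q s).1.1) q'.1.1 J t :=
  ((ContinuousLinearMap.fst ℝ (Stack N n) (Stack N m)).comp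
    (ContinuousLinearMap.fst ℝ _ (Stack N (fun _ => d) × Stack N (fun _ => d)))).hasFDerivAt.comp_hasDerivWithinAt t hq

lemma hasDerivWithinAt_u (hq : HasDerivWithinAt q q' J t) :
    HasDerivWithinAt (fun s => (q s).1.2) q'.1.2 J t :=
  ((ContinuousLinearMap.snd ℝ (Stack N n) (Stack N m)).comp
    (ContinuousLinearMap.fst ℝ _ (Stack N (fun _ => d) × Stack N (fun _ => d)))).hasFDerivAt.comp_hasDerivWithinAt t hq

lemma hasDerivWithinAt_w (hq : HasDerivWithinAt q q' J t) :
    HasDerivWithinAt (fun s => (q s).2.1) q'.2.1 J t :=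
  ((ContinuousLinearMap.fst ℝ (Stack N (fun _ => d)) (Stack N (fun _ => d))).comp
    (ContinuousLinearMap.snd ℝ (Stack N n × Stack N m) _)).hasFDerivAt.comp_hasDerivWithinAt t hq

lemma hasDerivWithinAt_z (hq : HasDerivWithinAt q q' J t) :
    HasDerivWithinAt (fun s => (q s).2.2) q'.2.2 J t :=
  ((ContinuousLinearMap.snd ℝ (Stack N (fun _ => d)) (Stack N (fun _ => d))).comp
    (ContinuousLinearMap.snd ℝ (Stack N n × Stack N m) _)).hasFDerivAt.comp_hasDerivWithinAt t hq

end Components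

lemma norm_plant_le {L : ℝ} (h1 : P.SteadyStateAssumption)
    (hL : ∀ x x' u, ‖P.plant x u - P.plant x' u‖ ≤ L * ‖x - x'‖) (x : Stack N n) (u : Stack N m) :
    ‖P.plant x u‖ ≤ L * ‖x - P.steady u‖ := by
  simpa [h1.plant_steady] using hL x (P.steady u) u

lemma CostAssumption.hasDerivWithinAt_aggEstimate (h2 : P.CostAssumption)
    {q : ℝ → ClosedLoopState N n m d} {q' : ClosedLoopState N n m d} {J : Set ℝ} {t : ℝ}
    (hq : HasDerivWithinAt q q' J t) : HasDerivWithinAt (fun s => P.aggEstimate (q s))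
      (q'.2.1 + fderiv ℝ P.contribution (q t).1.1 q'.1.1) J t :=
  (hasDerivWithinAt_w hq).add ((h2.differentiable_contribution _).hasFDerivAt.comp_hasDerivWithinAt
    t (hasDerivWithinAt_x hq))

lemma exists_norm_le_mul {E F : Type*} [NormedAddCommGroup E] [NormedSpace ℝ E]
    [NormedAddCommGroup F] [NormedSpace ℝ F] (A : E →L[ℝ] F) : ∃ L ≥ 0, ∀ y, ‖A y‖ ≤ L * ‖y‖ :=
  ⟨‖A‖, norm_nonneg A, A.le_opNorm⟩

section Disagreement

variable {l Δ κ : ℝ} {q : ℝ → ClosedLoopState N n m d} {q' : ClosedLoopState N n m d} {t : ℝ}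

/-- The Laplacian keeps deviations zero-sum and contracts them at rate `κ * l`; the only forcing is
the motion of the contributions with the plants. -/
lemma hasUpperDerivAt_aggDisagreement_sq (hN : 0 < N) (h2 : P.CostAssumption)
    (h3 : P.GraphAssumption) (hκ : 0 ≤ κ)
    (hlap : ∀ y : Stack N (fun _ => d), ∑ i, y i = 0 → l * ‖y‖ ^ 2 ≤ ⟪y, P.laplacian y⟫_ℝ)
    (hΔ : ∀ y, ‖blockDeviation N d y‖ ≤ Δ * ‖y‖) (hq : HasDerivWithinAt q q' (Ici t) t)
    (hw : q'.2.1 = -(κ • P.laplacian (blockDeviation N d (P.aggEstimate (q t))))) :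
    HasUpperDerivAt (fun s => P.aggDisagreement (q s) ^ 2) (2 * P.aggDisagreement (q t) *
      (-κ * l * P.aggDisagreement (q t)
        + Δ * ‖fderiv ℝ P.contribution (q t).1.1 q'.1.1‖)) t := by
  have hs := h2.hasDerivWithinAt_aggEstimate hq
  generalize fderiv ℝ P.contribution (q t).1.1 q'.1.1 = ξ at hs ⊢
  rw [hw] at hs
  have h := (((blockDeviation N d).hasFDerivAt.comp_hasDerivWithinAt t hs).norm_sq)
  refine (HasUpperDerivAt.of_hasDerivWithinAt h).mono ?_
  change 2 * ⟪blockDeviation N d (P.aggEstimate (q t)), _⟫_ℝ ≤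
    2 * ‖blockDeviation N d (P.aggEstimate (q t))‖
      * (-κ * l * ‖blockDeviation N d (P.aggEstimate (q t))‖ + _)
  have hy := sum_blockDeviation hN (P.aggEstimate (q t))
  generalize blockDeviation N d (P.aggEstimate (q t)) = y at hy ⊢
  rw [map_add, map_neg, map_smul, h3.blockDeviation_laplacian, inner_add_right, inner_neg_right,
    inner_smul_right]
  have e1 : ⟪y, blockDeviation N d ξ⟫_ℝ ≤ ‖y‖ * (Δ * ‖ξ‖) :=
    (real_inner_le_norm _ _).trans (mul_le_mul_of_nonneg_left (hΔ ξ) (norm_nonneg y))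
  have e3 := mul_le_mul_of_nonneg_left (hlap y hy) hκ
  linarith

/-- The `∇₂f_i` are Lipschitz but perhaps not differentiable. Their arguments are frozen at time `t`
in the differentiable curve, and their variation goes into a perturbation that vanishes at `t`. -/
lemma hasUpperDerivAt_gradDisagreement_sq (hN : 0 < N) (h2 : P.CostAssumption)
    (h3 : P.GraphAssumption) {L : ℝ} (hκ : 0 ≤ κ)
    (hlap : ∀ y : Stack N (fun _ => d), ∑ i, y i = 0 → l * ‖y‖ ^ 2 ≤ ⟪y, P.laplacian y⟫_ℝ)
    (hΔ0 : 0 ≤ Δ) (hΔ : ∀ y, ‖blockDeviation N d y‖ ≤ Δ * ‖y‖)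
    (hgrad : ∀ x x' s s',
      ‖P.grad2Stack x s - P.grad2Stack x' s'‖ ≤ L * (‖x - x'‖ + ‖s - s'‖))
    (hq : HasDerivWithinAt q q' (Ici t) t)
    (hz : q'.2.2 = -(κ • P.laplacian (blockDeviation N d (P.gradEstimate (q t))))) :
    HasUpperDerivAt (fun s => P.gradDisagreement (q s) ^ 2) (2 * P.gradDisagreement (q t) *
      (-κ * l * P.gradDisagreement (q t) + Δ * (L * (‖q'.1.1‖
        + ‖q'.2.1 + fderiv ℝ P.contribution (q t).1.1 q'.1.1‖)))) t := by
  have hx := hasDerivWithinAt_x hq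
  have hs := h2.hasDerivWithinAt_aggEstimate hq
  have hz' := hasDerivWithinAt_z hq
  generalize q'.2.1 + fderiv ℝ P.contribution (q t).1.1 q'.1.1 = s' at hs ⊢
  generalize q'.1.1 = x' at hx ⊢
  rw [hz] at hz'
  have hd1 := (hx.sub_const (q t).1.1).norm_of_eq_zero (by simp)
  have hd2 := (hs.sub_const (P.aggEstimate (q t))).norm_of_eq_zero (by simp)
  have hyd := (blockDeviation N d).hasFDerivAt.comp_hasDerivWithinAt t
    (hz'.add_const (P.grad2Stack (q t).1.1 (P.aggEstimate (q t))))
  have h := HasUpperDerivAt.sq_of_le_norm_add (f := fun s => P.gradDisagreement (q s)) hyd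
    ((hd1.add hd2).const_mul (Δ * L)) (by simp) (fun s => norm_nonneg _) rfl (fun s => ?_)
  · refine h.mono ?_
    change 2 * ⟪blockDeviation N d (P.gradEstimate (q t)), _⟫_ℝ
      + 2 * (‖blockDeviation N d (P.gradEstimate (q t))‖ * (Δ * L * (‖x'‖ + ‖s'‖))) ≤
      2 * ‖blockDeviation N d (P.gradEstimate (q t))‖
        * (-κ * l * ‖blockDeviation N d (P.gradEstimate (q t))‖ + _)
    have hζ := sum_blockDeviation hN (P.gradEstimate (q t))
    generalize blockDeviation N d (P.gradEstimate (q t)) = ζ at hζ ⊢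
    rw [map_neg, map_smul, h3.blockDeviation_laplacian, inner_neg_right, inner_smul_right]
    have e3 := mul_le_mul_of_nonneg_left (hlap ζ hζ) hκ
    linarith
  · change ‖blockDeviation N d (P.gradEstimate (q s))‖ ≤
      ‖blockDeviation N d ((q s).2.2 + P.grad2Stack (q t).1.1 (P.aggEstimate (q t)))‖
      + Δ * L * (‖(q s).1.1 - (q t).1.1‖ + ‖P.aggEstimate (q s) - P.aggEstimate (q t)‖)
    have e1 : P.gradEstimate (q s) = ((q s).2.2 + P.grad2Stack (q t).1.1 (P.aggEstimate (q t)))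
        + (P.grad2Stack (q s).1.1 (P.aggEstimate (q s))
          - P.grad2Stack (q t).1.1 (P.aggEstimate (q t))) := by
      rw [gradEstimate]; abel
    rw [e1, map_add]
    refine (norm_add_le _ _).trans (add_le_add le_rfl ((hΔ _).trans ?_))
    rw [mul_assoc]
    exact mul_le_mul_of_nonneg_left (hgrad _ _ _ _) hΔ0

end Disagreement

/-- All forcing is bounded by the plant error, since the plants are at rest at their steady states,
except that the consensus motion of `w` also drives the second disagreement, at the rate `α₁ / α₂`.
The first is not driven by the second; this cascade lets the weights be chosen one after the other.
-/
lemma exists_hasUpperDerivAt_disagreement (hN : 0 < N) (h1 : P.SteadyStateAssumption)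
    (h2 : P.CostAssumption) (h3 : P.GraphAssumption) :
    ∃ l > 0, ∃ C > 0, ∀ (α₁ α₂ : ℝ) (q : ℝ → ClosedLoopState N n m d) (t X : ℝ),
      0 < α₁ → 0 < α₂ → HasDerivWithinAt q (P.closedLoop α₁ α₂ (q t)) (Ici t) t →
      ‖(q t).1.1 - P.steady (q t).1.2‖ ≤ X →
      HasUpperDerivAt (fun s => P.aggDisagreement (q s) ^ 2) (2 * P.aggDisagreement (q t) *
        (-(α₁ / α₂) * l * P.aggDisagreement (q t) + C * X)) t ∧
      HasUpperDerivAt (fun s => P.gradDisagreement (q s) ^ 2) (2 * P.gradDisagreement (q t) *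
        (-(α₁ / α₂) * l * P.gradDisagreement (q t) +
          C * (X + α₁ / α₂ * P.aggDisagreement (q t)))) t := by
  obtain ⟨l, hl, hlap⟩ := h3.exists_le_inner_laplacian (d := d) hN
  obtain ⟨Lp, hLp, hplant, -⟩ := h1.exists_norm_plant_sub_le
  obtain ⟨L₃, hL₃, hcontr⟩ := h2.exists_norm_contribution_sub_le
  obtain ⟨L₂, hL₂, hgrad⟩ := h2.exists_norm_grad2Stack_sub_le
  obtain ⟨Δ, hΔ0, hΔ⟩ := exists_norm_le_mul (blockDeviation N d)
  obtain ⟨Λ, hΛ0, hΛ⟩ := exists_norm_le_mul (P.laplacian (d := d))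
  refine ⟨l, hl, Δ * (L₃ * Lp) + Δ * L₂ * (Lp + Λ + L₃ * Lp) + 1, by positivity,
    fun α₁ α₂ q t X hα₁ hα₂ hq hX => ?_⟩
  have hκ0 : 0 ≤ α₁ / α₂ := by positivity
  have hX0 : 0 ≤ X := (norm_nonneg _).trans hX
  have hY0 : 0 ≤ P.aggDisagreement (q t) := norm_nonneg _
  have hZ0 : 0 ≤ P.gradDisagreement (q t) := norm_nonneg _
  obtain ⟨q', hq'⟩ : ∃ q', q' = P.closedLoop α₁ α₂ (q t) := ⟨_, rfl⟩
  rw [← hq'] at hq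
  rw [closedLoop_eq, ← laplacian_blockDeviation, ← P.laplacian_blockDeviation (P.gradEstimate _)]
    at hq'
  generalize α₁ / α₂ = κ at *
  have hx' : ‖q'.1.1‖ ≤ Lp * X := by
    rw [hq']
    exact (norm_plant_le h1 hplant _ _).trans (mul_le_mul_of_nonneg_left hX hLp.le)
  have hw : q'.2.1 = -(κ • P.laplacian (blockDeviation N d (P.aggEstimate (q t)))) := by rw [hq']
  have hz : q'.2.2 = -(κ • P.laplacian (blockDeviation N d (P.gradEstimate (q t)))) := by rw [hq']
  have hξ : ‖fderiv ℝ P.contribution (q t).1.1 q'.1.1‖ ≤ L₃ * (Lp * X) :=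
    (ContinuousLinearMap.le_opNorm _ _).trans (mul_le_mul
      (norm_fderiv_le_of_norm_sub_le hL₃ hcontr _) hx' (norm_nonneg _) hL₃.le)
  have hw' : ‖q'.2.1‖ ≤ κ * (Λ * P.aggDisagreement (q t)) := by
    rw [hw, norm_neg, norm_smul, Real.norm_of_nonneg hκ0]
    exact mul_le_mul_of_nonneg_left (hΛ _) hκ0
  clear hq'
  constructor
  · refine (hasUpperDerivAt_aggDisagreement_sq hN h2 h3 hκ0 hlap hΔ hq hw).mono ?_
    refine mul_le_mul_of_nonneg_left (add_le_add le_rfl ?_) (by positivity)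
    refine (mul_le_mul_of_nonneg_left hξ hΔ0).trans ?_
    have : 0 ≤ (Δ * L₂ * (Lp + Λ + L₃ * Lp) + 1) * X := by positivity
    linarith
  · refine (hasUpperDerivAt_gradDisagreement_sq hN h2 h3 hκ0 hlap hΔ0 hΔ hgrad hq hz).mono ?_
    refine mul_le_mul_of_nonneg_left (add_le_add le_rfl ?_) (by positivity)
    have e1 := (norm_add_le q'.2.1 (fderiv ℝ P.contribution (q t).1.1 q'.1.1)).trans
      (add_le_add hw' hξ)
    generalize P.aggDisagreement (q t) = Y at *
    have e5 : ‖q'.1.1‖ + ‖q'.2.1 + fderiv ℝ P.contribution (q t).1.1 q'.1.1‖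
        ≤ (Lp + Λ + L₃ * Lp) * (X + κ * Y) := by
      have : 0 ≤ Λ * X := by positivity
      have : 0 ≤ (Lp + L₃ * Lp) * (κ * Y) := by positivity
      linarith
    have e6 := mul_le_mul_of_nonneg_left (mul_le_mul_of_nonneg_left e5 hL₂.le) hΔ0
    refine e6.trans ?_
    have : 0 ≤ (Δ * (L₃ * Lp) + 1) * (X + κ * Y) := by positivity
    linarith

/-! ### The zero-sum set: perturbed gradient flow, growth of the field, coordinates, invariance. -/

lemma mem_zeroSumSet_iff (hN : 0 < N) {q : ClosedLoopState N n m d} : q ∈ zeroSumSet N n m d ↔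
    blockAverage N d q.2.1 = 0 ∧ blockAverage N d q.2.2 = 0 := by
  have : (N : ℝ) ≠ 0 := by positivity
  simp [zeroSumSet, blockAverage_apply, this]

/-- On the zero-sum set, the input dynamics are a perturbed gradient flow. -/
lemma exists_norm_gradSteady_direction_sub_le (hN : 0 < N) (h1 : P.SteadyStateAssumption)
    (h2 : P.CostAssumption) : ∃ C > 0, ∀ q ∈ zeroSumSet N n m d,
      ‖P.gradSteady q.1.2 (P.direction q.1.1 (P.aggEstimate q) (P.gradEstimate q))
        - ∇ P.reducedCost q.1.2‖ ≤
      C * (‖q.1.1 - P.steady q.1.2‖ + P.aggDisagreement q + P.gradDisagreement q) := by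
  obtain ⟨Lg, hLg, hgs⟩ := h1.exists_norm_gradSteady_le
  obtain ⟨L₀, hL₀, hcost⟩ := h2.lipschitz_cost
  obtain ⟨L₂, hL₂, hgrad⟩ := h2.exists_norm_grad2Stack_sub_le
  obtain ⟨L₁, hL₁, hdir⟩ := h2.exists_norm_direction_sub_le
  set A := ‖(constBlocks N d).comp (blockAverage N d)‖ with hA
  refine ⟨Lg * (L₁ * (1 + A * L₂) + L₀), by positivity, fun q hq => ?_⟩
  rw [mem_zeroSumSet_iff hN] at hq
  set x := q.1.1
  set s := P.aggEstimate q with hs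
  set g := P.gradEstimate q with hg
  set σ := constBlocks N d (P.sigma x) with hσ
  set γ := constBlocks N d (blockAverage N d (P.grad2Stack x σ)) with hγ
  -- As `w` has zero average, the average of the estimates `s` is exactly `σ(x)`.
  have hsσ : ‖s - σ‖ = P.aggDisagreement q := by
    rw [aggDisagreement, blockDeviation_apply, aggEstimate, map_add, hq.1, zero_add]
    rfl
  -- The average of `g` is that of the gradients at the estimates `s`, not at `σ(x)`; the second
  -- term pays for the difference.
  have hgγ : ‖g - γ‖ ≤ P.gradDisagreement q + A * (L₂ * P.aggDisagreement q) := by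
    have e1 : g - γ = blockDeviation N d g
        + (constBlocks N d).comp (blockAverage N d) (P.grad2Stack x s - P.grad2Stack x σ) := by
      rw [blockDeviation_apply, ContinuousLinearMap.comp_apply, map_sub, map_sub]
      have : blockAverage N d g = blockAverage N d (P.grad2Stack x s) := by
        rw [hg, gradEstimate, map_add, hq.2, zero_add]
      rw [this, hγ]
      abel
    rw [e1]
    refine (norm_add_le _ _).trans (add_le_add le_rfl ((ContinuousLinearMap.le_opNorm _ _).trans ?_))
    have := hgrad x x s σ
    rw [sub_self, norm_zero, zero_add, hsσ] at this
    gcongr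
  rw [gradient_reducedCost h1 h2, ← gradSteady_sub]
  have hd1 : ‖P.direction x s g - ∇ P.cost x‖ ≤ L₁ * (1 + A * L₂) *
      (P.aggDisagreement q + P.gradDisagreement q) := by
    rw [h2.gradient_cost]
    refine (hdir x s σ g γ).trans ?_
    rw [mul_assoc]
    gcongr
    rw [hsσ]
    have : 0 ≤ A * L₂ * P.gradDisagreement q :=
      mul_nonneg (by positivity) (norm_nonneg _)
    linarith
  have hd2 : ‖P.direction x s g - ∇ P.cost (P.steady q.1.2)‖ ≤ (L₁ * (1 + A * L₂) + L₀) *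
      (‖x - P.steady q.1.2‖ + P.aggDisagreement q + P.gradDisagreement q) := by
    calc _ ≤ ‖P.direction x s g - ∇ P.cost x‖ + ‖∇ P.cost x - ∇ P.cost (P.steady q.1.2)‖ :=
          norm_sub_le_norm_sub_add_norm_sub _ _ _
      _ ≤ L₁ * (1 + A * L₂) * (P.aggDisagreement q + P.gradDisagreement q)
          + L₀ * ‖x - P.steady q.1.2‖ := add_le_add hd1 (hcost _ _)
      _ ≤ _ := by
        have e1 : 0 ≤ L₁ * (1 + A * L₂) * ‖x - P.steady q.1.2‖ := by positivity
        have e2 : 0 ≤ L₀ * (P.aggDisagreement q + P.gradDisagreement q) :=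
          mul_nonneg hL₀.le (add_nonneg (norm_nonneg _) (norm_nonneg _))
        linarith
  refine (hgs _ _).trans ?_
  rw [mul_assoc]
  gcongr

/-! Continuity of the stacked maps -/

lemma SteadyStateAssumption.continuous_steady (h1 : P.SteadyStateAssumption) :
    Continuous P.steady :=
  (PiLp.continuous_toLp 2 _).comp (continuous_pi fun i =>
    (h1.smooth i).continuous.comp (PiLp.continuous_apply 2 _ i))

lemma CostAssumption.continuous_contribution (h2 : P.CostAssumption) :
    Continuous P.contribution := h2.differentiable_contribution.continuous

lemma CostAssumption.continuous_grad2Stack (h2 : P.CostAssumption) :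
    Continuous fun r : Stack N n × Stack N (fun _ => d) => P.grad2Stack r.1 r.2 :=
  (PiLp.continuous_toLp 2 _).comp (continuous_pi fun i => (h2.continuous_grad2 i).comp
    (f := fun r : Stack N n × Stack N (fun _ => d) => (r.1 i, r.2 i)) (by fun_prop))

lemma CostAssumption.continuous_aggEstimate (h2 : P.CostAssumption) :
    Continuous P.aggEstimate :=
  (continuous_fst.comp continuous_snd).add
    (h2.continuous_contribution.comp (continuous_fst.comp continuous_fst))

lemma CostAssumption.continuous_gradEstimate (h2 : P.CostAssumption) :
    Continuous P.gradEstimate :=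
  (continuous_snd.comp continuous_snd).add
    (h2.continuous_grad2Stack.comp
      ((continuous_fst.comp continuous_fst).prodMk h2.continuous_aggEstimate))

lemma CostAssumption.continuous_sigma (h2 : P.CostAssumption) : Continuous P.sigma :=
  (blockAverage N d).continuous.comp h2.continuous_contribution

lemma CostAssumption.continuous_errorVector (h2 : P.CostAssumption) :
    Continuous P.errorVector := by
  have hw : Continuous P.piw := by
    rw [funext P.piw_eq]
    exact ((blockDeviation N d).continuous.comp h2.continuous_contribution).neg
  have hz : Continuous P.piz := by
    rw [funext P.piz_eq]
    exact ((blockDeviation N d).continuous.comp (h2.continuous_grad2Stack.comp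
      (continuous_id.prodMk ((constBlocks N d).continuous.comp h2.continuous_sigma)))).neg
  have hx : Continuous fun q : ClosedLoopState N n m d => q.1.1 :=
    continuous_fst.comp continuous_fst
  exact continuous_fst.prodMk (((continuous_fst.comp continuous_snd).sub (hw.comp hx)).prodMk
    ((continuous_snd.comp continuous_snd).sub (hz.comp hx)))

lemma isClosed_zeroSumSet : IsClosed (zeroSumSet N n m d) := by
  refine IsClosed.inter (isClosed_eq ?_ continuous_const) (isClosed_eq ?_ continuous_const) <;>
  fun_prop

/-- The vector field is bounded by a continuous function. -/
lemma exists_norm_closedLoop_le (h1 : P.SteadyStateAssumption)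
    (h2 : P.CostAssumption) (α₁ α₂ : ℝ) : ∃ b : ClosedLoopState N n m d → ℝ, Continuous b ∧
      ∀ q, ‖P.closedLoop α₁ α₂ q‖ ≤ b q := by
  obtain ⟨Lp, hLp, hplant, -⟩ := h1.exists_norm_plant_sub_le
  obtain ⟨Lg, hLg, hgs⟩ := h1.exists_norm_gradSteady_le
  obtain ⟨L₁, hL₁, hdir⟩ := h2.exists_norm_direction_sub_le
  have hx : Continuous fun q : ClosedLoopState N n m d => q.1.1 :=
    continuous_fst.comp continuous_fst
  have hu : Continuous fun q : ClosedLoopState N n m d => q.1.2 :=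
    continuous_snd.comp continuous_fst
  have hc : Continuous fun q : ClosedLoopState N n m d => ∇ P.cost q.1.1 :=
    Continuous.comp (g := ∇ P.cost) h2.continuous_gradient_cost hx
  -- The direction need not be continuous in `x`, but at the exact averages it equals the continuous
  -- gradient of the cost, and its distance from there is controlled.
  obtain ⟨σ, γ, hσ, hγ, hcost⟩ : ∃ σ γ : ClosedLoopState N n m d → Stack N (fun _ => d),
      Continuous σ ∧ Continuous γ ∧ ∀ q, ∇ P.cost q.1.1 = P.direction q.1.1 (σ q) (γ q) := by
    have hσ : Continuous fun q : ClosedLoopState N n m d => constBlocks N d (P.sigma q.1.1) :=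
      (constBlocks N d).continuous.comp (h2.continuous_sigma.comp hx)
    exact ⟨_, fun q => constBlocks N d (blockAverage N d (P.grad2Stack q.1.1
      (constBlocks N d (P.sigma q.1.1)))), hσ, (constBlocks N d).continuous.comp
        ((blockAverage N d).continuous.comp (h2.continuous_grad2Stack.comp (hx.prodMk hσ))),
      fun q => h2.gradient_cost _⟩
  have hs := h2.continuous_aggEstimate
  have hg := h2.continuous_gradEstimate
  have hst := h1.continuous_steady.comp hu
  have c1 : Continuous fun q : ClosedLoopState N n m d => Lp * ‖q.1.1 - P.steady q.1.2‖ :=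
    continuous_const.mul (hx.sub hst).norm
  have c2 : Continuous fun q => |α₁| * (Lg * (L₁ * (‖P.aggEstimate q - σ q‖
      + ‖P.gradEstimate q - γ q‖) + ‖∇ P.cost q.1.1‖)) :=
    continuous_const.mul (continuous_const.mul ((continuous_const.mul
      ((hs.sub hσ).norm.add (hg.sub hγ).norm)).add hc.norm))
  have c3 : Continuous fun q => |α₁ / α₂| * ‖P.laplacian (P.aggEstimate q)‖ :=
    continuous_const.mul (P.laplacian.continuous.comp hs).norm
  have c4 : Continuous fun q => |α₁ / α₂| * ‖P.laplacian (P.gradEstimate q)‖ :=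
    continuous_const.mul (P.laplacian.continuous.comp hg).norm
  refine ⟨_, (c1.max c2).max (c3.max c4), fun q => ?_⟩
  rw [closedLoop_eq]
  refine max_le_max (max_le_max (norm_plant_le h1 hplant q.1.1 q.1.2) ?_) (max_le_max ?_ ?_) <;>
    dsimp only
  · rw [norm_neg, norm_smul, Real.norm_eq_abs, hcost]
    refine mul_le_mul_of_nonneg_left ((hgs _ _).trans (mul_le_mul_of_nonneg_left ?_ hLg.le))
      (abs_nonneg _)
    exact (norm_le_norm_sub_add _ (P.direction q.1.1 (σ q) (γ q))).trans
      (add_le_add (hdir _ _ _ _ _) le_rfl)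
  · rw [norm_neg, norm_smul, Real.norm_eq_abs]
  · rw [norm_neg, norm_smul, Real.norm_eq_abs]

/-- The state in terms of the tracking error, the input and the disagreements. -/
def reconstruct (P : AgentNetwork N n m d) (r : ClosedLoopState N n m d) :
    ClosedLoopState N n m d :=
  let x := r.1.1 + P.steady r.1.2
  let w := r.2.1 - blockDeviation N d (P.contribution x)
  ((x, r.1.2), (w, r.2.2 - blockDeviation N d (P.grad2Stack x (w + P.contribution x))))

lemma continuous_reconstruct (h1 : P.SteadyStateAssumption) (h2 : P.CostAssumption) :
    Continuous P.reconstruct := by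
  have hx : Continuous fun r : ClosedLoopState N n m d => r.1.1 + P.steady r.1.2 :=
    (continuous_fst.comp continuous_fst).add
      (h1.continuous_steady.comp (continuous_snd.comp continuous_fst))
  have hφ := h2.continuous_contribution.comp hx
  have hw : Continuous fun r : ClosedLoopState N n m d => r.2.1
      - blockDeviation N d (P.contribution (r.1.1 + P.steady r.1.2)) :=
    (continuous_fst.comp continuous_snd).sub ((blockDeviation N d).continuous.comp hφ)
  exact (hx.prodMk (continuous_snd.comp continuous_fst)).prodMk (hw.prodMk
    ((continuous_snd.comp continuous_snd).sub ((blockDeviation N d).continuous.comp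
      (h2.continuous_grad2Stack.comp (hx.prodMk (hw.add hφ))))))

/-- A zero-sum vector is its own deviation, so removing the known deviations recovers `w` and then
`z`. With continuity of `reconstruct`, bounds on these coordinates become bounds on the state. -/
lemma reconstruct_eq {q : ClosedLoopState N n m d} (hq : q ∈ zeroSumSet N n m d) :
    P.reconstruct ((q.1.1 - P.steady q.1.2, q.1.2), (blockDeviation N d (P.aggEstimate q),
      blockDeviation N d (P.gradEstimate q))) = q := by
  have hw : blockDeviation N d (P.aggEstimate q) - blockDeviation N d (P.contribution q.1.1)
      = q.2.1 := by
    rw [← map_sub, aggEstimate, add_sub_cancel_right, blockDeviation_eq_self hq.1]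
  have hz : blockDeviation N d (P.gradEstimate q)
      - blockDeviation N d (P.grad2Stack q.1.1 (P.aggEstimate q)) = q.2.2 := by
    rw [← map_sub, gradEstimate, add_sub_cancel_right, blockDeviation_eq_self hq.2]
  simp only [reconstruct, sub_add_cancel, hw]
  refine Prod.ext rfl (Prod.ext rfl ?_)
  exact hz

lemma reconstruct_zero (u : Stack N m) : P.reconstruct ((0, u), (0, 0)) =
    ((P.steady u, u), (P.piw (P.steady u), P.piz (P.steady u))) := by
  have hw : -blockDeviation N d (P.contribution (P.steady u)) + P.contribution (P.steady u)
      = constBlocks N d (P.sigma (P.steady u)) := by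
    rw [blockDeviation_apply, sigma_eq_blockAverage]; abel
  simp only [reconstruct, zero_add, zero_sub, piw_eq, piz_eq, hw]

/-- A state in the zero-sum set without tracking error and disagreements is determined by
its input. -/
lemma eq_of_disagreement_eq_zero {q : ClosedLoopState N n m d} (hq : q ∈ zeroSumSet N n m d)
    (hx : q.1.1 - P.steady q.1.2 = 0) (hY : P.aggDisagreement q = 0)
    (hZ : P.gradDisagreement q = 0) : q = ((P.steady q.1.2, q.1.2),
      (P.piw (P.steady q.1.2), P.piz (P.steady q.1.2))) := by
  rw [← reconstruct_zero, ← hx]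
  nth_rw 1 [← reconstruct_eq (P := P) hq]
  rw [norm_eq_zero.1 hY, norm_eq_zero.1 hZ, hx]

/-- The zero-sum set is forward invariant. -/
lemma GraphAssumption.mem_zeroSumSet (hN : 0 < N) (h3 : P.GraphAssumption) {α₁ α₂ : ℝ}
    {q : ℝ → ClosedLoopState N n m d} {t : ℝ}
    (hq : IsSolutionOn (P.closedLoop α₁ α₂) (Icc 0 t) q) (h0 : q 0 ∈ zeroSumSet N n m d)
    (ht : 0 ≤ t) : q t ∈ zeroSumSet N n m d := by
  -- Weight balance: the columns of the Laplacian sum to zero, so the averages of `w` and `z` are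
  -- conserved.
  have hlap : ∀ y : Stack N (fun _ => d), blockAverage N d (-((α₁ / α₂) • P.laplacian y)) = 0 :=
    fun y => by rw [map_neg, map_smul, blockAverage_apply, h3.sum_laplacian]; simp
  rw [mem_zeroSumSet_iff hN] at h0 ⊢
  have hqc := hq.continuousOn
  constructor
  · rw [← h0.1]
    refine constant_of_has_deriv_right_zero (f := fun s => blockAverage N d (q s).2.1) (a := 0)
      (b := t) ((by fun_prop : Continuous fun q : ClosedLoopState N n m d =>
        blockAverage N d q.2.1).comp_continuousOn hqc)
      (fun s hs => ?_) t ⟨ht, le_rfl⟩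
    have h := hq.hasDerivWithinAt_Ici hs
    rw [closedLoop_eq] at h
    have := (blockAverage N d).hasFDerivAt.comp_hasDerivWithinAt s (hasDerivWithinAt_w h)
    rwa [hlap] at this
  · rw [← h0.2]
    refine constant_of_has_deriv_right_zero (f := fun s => blockAverage N d (q s).2.2) (a := 0)
      (b := t) ((by fun_prop : Continuous fun q : ClosedLoopState N n m d =>
        blockAverage N d q.2.2).comp_continuousOn hqc)
      (fun s hs => ?_) t ⟨ht, le_rfl⟩
    have h := hq.hasDerivWithinAt_Ici hs
    rw [closedLoop_eq] at h
    have := (blockAverage N d).hasFDerivAt.comp_hasDerivWithinAt s (hasDerivWithinAt_z h)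
    rwa [hlap] at this

end AgentNetwork

/-! Locally Lipschitz maps -/

section LocallyLipschitz

lemma locallyLipschitz_uncurry_of_norm_sub_le {E F G : Type*} [NormedAddCommGroup E]
    [NormedAddCommGroup F] [NormedAddCommGroup G] {f : E → F → G} {L : ℝ} (hL : 0 < L)
    (h : ∀ x x' y y', ‖f x y - f x' y'‖ ≤ L * (‖x - x'‖ + ‖y - y'‖)) :
    LocallyLipschitz fun r : E × F => f r.1 r.2 := by
  refine (LipschitzWith.of_dist_le_mul (K := (2 * L).toNNReal) fun r r' => ?_).locallyLipschitz
  rw [Real.coe_toNNReal _ (by positivity), dist_eq_norm, dist_eq_norm]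
  have h1 := norm_fst_le (r - r')
  have h2 := norm_snd_le (r - r')
  rw [Prod.fst_sub] at h1
  rw [Prod.snd_sub] at h2
  calc _ ≤ L * (‖r.1 - r'.1‖ + ‖r.2 - r'.2‖) := h _ _ _ _
    _ ≤ L * (‖r - r'‖ + ‖r - r'‖) := by gcongr
    _ = _ := by ring

lemma LocallyLipschitz.comp_uncurry {X E F G : Type*} [PseudoEMetricSpace X]
    [NormedAddCommGroup E] [NormedAddCommGroup F] [NormedAddCommGroup G] {f : E → F → G}
    {a : X → E} {b : X → F} (hf : LocallyLipschitz fun r : E × F => f r.1 r.2)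
    (ha : LocallyLipschitz a) (hb : LocallyLipschitz b) : LocallyLipschitz fun x => f (a x) (b x) :=
  hf.comp (ha.prodMk hb)

variable {E F G : Type*} [PseudoEMetricSpace E] [NormedAddCommGroup F]
  [NormedSpace ℝ F] [NormedAddCommGroup G] [NormedSpace ℝ G]

lemma LocallyLipschitz.add_fun {f g : E → F} (hf : LocallyLipschitz f) (hg : LocallyLipschitz g) :
    LocallyLipschitz fun x => f x + g x :=
  ((contDiff_fst.add contDiff_snd : ContDiff ℝ 1 fun r : F × F => r.1 + r.2).locallyLipschitz).comp
    (hf.prodMk hg)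

lemma LocallyLipschitz.clm_comp {f : E → F} (hf : LocallyLipschitz f) (A : F →L[ℝ] G) :
    LocallyLipschitz fun x => A (f x) :=
  A.lipschitz.locallyLipschitz.comp hf

lemma LocallyLipschitz.neg_const_smul {f : E → F} (hf : LocallyLipschitz f) (c : ℝ) :
    LocallyLipschitz fun x => -(c • f x) :=
  hf.clm_comp (-(c • .id ℝ F))

lemma LocallyLipschitz.clm_apply {A : E → F →L[ℝ] G} {f : E → F} (hA : LocallyLipschitz A)
    (hf : LocallyLipschitz f) : LocallyLipschitz fun x => A x (f x) :=
  ((isBoundedBilinearMap_apply (𝕜 := ℝ) (E := F) (F := G)).contDiff (n := 1)).locallyLipschitz.comp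
    (hA.prodMk hf)

lemma LocallyLipschitz.toLp {N : ℕ} {β : Fin N → Type*} [∀ i, NormedAddCommGroup (β i)]
    [∀ i, NormedSpace ℝ (β i)] {f : ∀ i, E → β i} (hf : ∀ i, LocallyLipschitz (f i)) :
    LocallyLipschitz fun x => (WithLp.toLp 2 fun i => f i x : PiLp 2 β) := by
  have hpi : LocallyLipschitz fun x i => f i x := fun x => by
    choose K s hs hK using fun i => hf i x
    refine ⟨Finset.univ.sup K, ⋂ i, s i, (iInter_mem).2 hs, fun y hy z hz => ?_⟩
    refine edist_pi_le_iff.2 fun i => ?_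
    refine (hK i (mem_iInter.1 hy i) (mem_iInter.1 hz i)).trans ?_
    gcongr
    exact Finset.le_sup (Finset.mem_univ i)
  exact hpi.clm_comp (PiLp.continuousLinearEquiv 2 ℝ β).symm.toContinuousLinearMap

end LocallyLipschitz

namespace AgentNetwork

variable {N : ℕ} {n m : Fin N → ℕ} {d : ℕ} {P : AgentNetwork N n m d}

lemma locallyLipschitz_x (i : Fin N) :
    LocallyLipschitz fun q : ClosedLoopState N n m d => q.1.1 i :=
  (by fun_prop : ContDiff ℝ 1 fun q : ClosedLoopState N n m d => q.1.1 i).locallyLipschitz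

lemma locallyLipschitz_u (i : Fin N) :
    LocallyLipschitz fun q : ClosedLoopState N n m d => q.1.2 i :=
  (by fun_prop : ContDiff ℝ 1 fun q : ClosedLoopState N n m d => q.1.2 i).locallyLipschitz

lemma locallyLipschitz_block {f : ClosedLoopState N n m d → Stack N (fun _ => d)}
    (hf : LocallyLipschitz f) (i : Fin N) : LocallyLipschitz fun q => f q i :=
  hf.clm_comp (PiLp.proj 2 (𝕜 := ℝ) (fun _ : Fin N => EuclideanSpace ℝ (Fin d)) i)

lemma CostAssumption.locallyLipschitz_grad1 (h2 : P.CostAssumption) (i : Fin N) :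
    LocallyLipschitz fun r : EuclideanSpace ℝ (Fin (n i)) × EuclideanSpace ℝ (Fin d) =>
      P.grad1 i r.1 r.2 := by
  obtain ⟨L, hL, h⟩ := h2.lipschitz1
  exact locallyLipschitz_uncurry_of_norm_sub_le hL fun x x' y y' => (h i x x' y y').trans
    (mul_le_mul_of_nonneg_left (sqrt_add_sq_le_add (norm_nonneg _) (norm_nonneg _)) hL.le)

lemma CostAssumption.locallyLipschitz_grad2 (h2 : P.CostAssumption) (i : Fin N) :
    LocallyLipschitz fun r : EuclideanSpace ℝ (Fin (n i)) × EuclideanSpace ℝ (Fin d) =>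
      P.grad2 i r.1 r.2 := by
  obtain ⟨L, hL, h⟩ := h2.lipschitz2
  exact locallyLipschitz_uncurry_of_norm_sub_le hL fun x x' y y' => (h i x x' y y').trans
    (mul_le_mul_of_nonneg_left (sqrt_add_sq_le_add (norm_nonneg _) (norm_nonneg _)) hL.le)

lemma CostAssumption.locallyLipschitz_aggEstimate (h2 : P.CostAssumption) :
    LocallyLipschitz P.aggEstimate := by
  have hw : LocallyLipschitz fun q : ClosedLoopState N n m d => q.2.1 :=
    (by fun_prop : ContDiff ℝ 1 fun q : ClosedLoopState N n m d => q.2.1).locallyLipschitz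
  refine hw.add_fun (LocallyLipschitz.toLp fun i => ?_)
  obtain ⟨L, hL, h⟩ := h2.lipschitz_φ
  exact ((LipschitzWith.of_dist_le_mul (f := P.φ i) (K := L.toNNReal) fun x x' => by
    rw [Real.coe_toNNReal _ hL.le, dist_eq_norm, dist_eq_norm]
    exact h i x x').locallyLipschitz).comp (locallyLipschitz_x i)

lemma CostAssumption.locallyLipschitz_gradEstimate (h2 : P.CostAssumption) :
    LocallyLipschitz P.gradEstimate := by
  have hz : LocallyLipschitz fun q : ClosedLoopState N n m d => q.2.2 :=
    (by fun_prop : ContDiff ℝ 1 fun q : ClosedLoopState N n m d => q.2.2).locallyLipschitz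
  refine hz.add_fun (LocallyLipschitz.toLp fun i => ?_)
  exact LocallyLipschitz.comp_uncurry (f := P.grad2 i) (h2.locallyLipschitz_grad2 i)
    (locallyLipschitz_x i) (locallyLipschitz_block h2.locallyLipschitz_aggEstimate i)

lemma CostAssumption.locallyLipschitz_direction (h2 : P.CostAssumption)
    (hφ : ∀ i, LocallyLipschitz (P.gradφ i)) (i : Fin N) : LocallyLipschitz fun q =>
      P.direction q.1.1 (P.aggEstimate q) (P.gradEstimate q) i := by
  have h1 : LocallyLipschitz fun q => P.grad1 i (q.1.1 i) (P.aggEstimate q i) :=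
    LocallyLipschitz.comp_uncurry (f := P.grad1 i) (h2.locallyLipschitz_grad1 i)
      (locallyLipschitz_x i) (locallyLipschitz_block h2.locallyLipschitz_aggEstimate i)
  exact h1.add_fun (((hφ i).comp (locallyLipschitz_x i)).clm_apply
    (locallyLipschitz_block h2.locallyLipschitz_gradEstimate i))

lemma SteadyStateAssumption.locallyLipschitz_plant (h1 : P.SteadyStateAssumption) :
    LocallyLipschitz fun q : ClosedLoopState N n m d => P.plant q.1.1 q.1.2 := by
  refine LocallyLipschitz.toLp fun i => ?_
  obtain ⟨L, hL, h⟩ := h1.lipschitz_p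
  have hp : LocallyLipschitz fun r : EuclideanSpace ℝ (Fin (n i)) × EuclideanSpace ℝ (Fin (m i)) =>
      P.p i r.1 r.2 := locallyLipschitz_uncurry_of_norm_sub_le hL fun x x' y y' => ?_
  · exact LocallyLipschitz.comp_uncurry (f := P.p i) hp (locallyLipschitz_x i)
      (locallyLipschitz_u i)
  rw [mul_add]
  exact (norm_sub_le_norm_sub_add_norm_sub _ (P.p i x' y) _).trans
    (add_le_add ((h i).1 _ _ _) ((h i).2 _ _ _))

lemma locallyLipschitz_gradSteady_direction (h2 : P.CostAssumption)
    (hh : ∀ i, LocallyLipschitz (P.gradh i)) (hφ : ∀ i, LocallyLipschitz (P.gradφ i)) :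
    LocallyLipschitz fun q => P.gradSteady q.1.2
      (P.direction q.1.1 (P.aggEstimate q) (P.gradEstimate q)) :=
  LocallyLipschitz.toLp fun i => LocallyLipschitz.clm_apply
    (A := fun q : ClosedLoopState N n m d => P.gradh i (q.1.2 i))
    ((hh i).comp (locallyLipschitz_u i)) (h2.locallyLipschitz_direction hφ i)

lemma locallyLipschitz_closedLoop (h1 : P.SteadyStateAssumption) (h2 : P.CostAssumption)
    (hh : ∀ i, LocallyLipschitz (P.gradh i)) (hφ : ∀ i, LocallyLipschitz (P.gradφ i))
    (α₁ α₂ : ℝ) : LocallyLipschitz (P.closedLoop α₁ α₂) := by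
  have hu := (locallyLipschitz_gradSteady_direction h2 hh hφ).neg_const_smul α₁
  have hw := (h2.locallyLipschitz_aggEstimate.clm_comp P.laplacian).neg_const_smul (α₁ / α₂)
  have hz := (h2.locallyLipschitz_gradEstimate.clm_comp P.laplacian).neg_const_smul (α₁ / α₂)
  rw [funext (P.closedLoop_eq α₁ α₂)]
  exact (h1.locallyLipschitz_plant.prodMk hu).prodMk (hw.prodMk hz)

/-! The steady states of the closed loop -/

variable (P) in
/-- The state in which the plants are at the steady state of the input `u` and the estimates
are exact. -/
def exactState (u : Stack N m) : ClosedLoopState N n m d :=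
  ((P.steady u, u), (P.piw (P.steady u), P.piz (P.steady u)))

lemma aggEstimate_exactState (u : Stack N m) :
    P.aggEstimate (P.exactState u) = constBlocks N d (P.sigma (P.steady u)) := by
  change P.piw (P.steady u) + P.contribution (P.steady u) = _
  rw [piw_eq, blockDeviation_apply, sigma_eq_blockAverage]
  abel

lemma gradEstimate_exactState (u : Stack N m) : P.gradEstimate (P.exactState u) =
    constBlocks N d (blockAverage N d (P.grad2Stack (P.steady u)
      (constBlocks N d (P.sigma (P.steady u))))) := by
  rw [gradEstimate, aggEstimate_exactState]
  change P.piz (P.steady u) + P.grad2Stack (P.steady u) _ = _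
  rw [piz_eq, blockDeviation_apply]
  abel

lemma aggDisagreement_exactState (hN : 0 < N) (u : Stack N m) :
    P.aggDisagreement (P.exactState u) = 0 := by
  rw [aggDisagreement, aggEstimate_exactState, blockDeviation_constBlocks hN, norm_zero]

lemma gradDisagreement_exactState (hN : 0 < N) (u : Stack N m) :
    P.gradDisagreement (P.exactState u) = 0 := by
  rw [gradDisagreement, gradEstimate_exactState, blockDeviation_constBlocks hN, norm_zero]

lemma exactState_mem_zeroSumSet (hN : 0 < N) (u : Stack N m) :
    P.exactState u ∈ zeroSumSet N n m d := by
  constructor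
  · have := sum_blockDeviation hN (-P.contribution (P.steady u))
    rwa [map_neg, ← piw_eq] at this
  · have := sum_blockDeviation hN (-P.grad2Stack (P.steady u)
      (constBlocks N d (P.sigma (P.steady u))))
    rwa [map_neg, ← piz_eq] at this

lemma closedLoop_exactState (h1 : P.SteadyStateAssumption) (h2 : P.CostAssumption) {u : Stack N m}
    (hu : ∇ P.reducedCost u = 0) (α₁ α₂ : ℝ) : P.closedLoop α₁ α₂ (P.exactState u) = 0 := by
  rw [closedLoop_eq, aggEstimate_exactState, gradEstimate_exactState, laplacian_constBlocks,
    laplacian_constBlocks]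
  change ((P.plant (P.steady u) u, -(α₁ • P.gradSteady u (P.direction (P.steady u) _ _))), _) = _
  rw [h1.plant_steady, ← h2.gradient_cost, ← gradient_reducedCost h1 h2, hu]
  simp

lemma errorVector_exactState_mem (h1 : P.SteadyStateAssumption) (h2 : P.CostAssumption)
    {u : Stack N m} (hu : ∇ P.reducedCost u = 0) : P.errorVector (P.exactState u) ∈
      P.stationarySet ×ˢ ({(0, 0)} : Set (Stack N (fun _ => d) × Stack N (fun _ => d))) := by
  refine ⟨mem_stationarySet h1 h2 hu, ?_⟩
  simp [errorVector, exactState]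

/-! The composite Lyapunov function -/

/-- The composite function made of the reduced cost, a plant Lyapunov function and
the disagreements. -/
def compositeLyapunov (P : AgentNetwork N n m d) (W : Stack N n → Stack N m → ℝ) (a b c : ℝ)
    (q : ClosedLoopState N n m d) : ℝ :=
  P.reducedCost q.1.2 + a * W q.1.1 q.1.2 ^ 2 + b * P.aggDisagreement q ^ 2
    + c * P.gradDisagreement q ^ 2

/-- The dissipation rate of the composite Lyapunov function. -/
def dissipationRate (P : AgentNetwork N n m d) (W : Stack N n → Stack N m → ℝ) (η : ℝ)
    (q : ClosedLoopState N n m d) : ℝ :=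
  η * (‖∇ P.reducedCost q.1.2‖ ^ 2 + W q.1.1 q.1.2 ^ 2 + P.aggDisagreement q ^ 2
    + P.gradDisagreement q ^ 2)

lemma CostAssumption.continuous_aggDisagreement (h2 : P.CostAssumption) :
    Continuous P.aggDisagreement :=
  ((blockDeviation N d).continuous.comp h2.continuous_aggEstimate).norm

lemma CostAssumption.continuous_gradDisagreement (h2 : P.CostAssumption) :
    Continuous P.gradDisagreement :=
  ((blockDeviation N d).continuous.comp h2.continuous_gradEstimate).norm

section Composite

variable {W : Stack N n → Stack N m → ℝ} {k r C : ℝ}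

lemma _root_.IsPlantLyapunov.continuous {E U : Type*} [NormedAddCommGroup E] [NormedSpace ℝ E]
    [NormedAddCommGroup U] [NormedSpace ℝ U] {p : E → U → E} {h : U → E} {W : E → U → ℝ}
    {k r C : ℝ} (hC : 0 < C) (hW : IsPlantLyapunov p h W k r C) :
    Continuous fun y : E × U => W y.1 y.2 :=
  (locallyLipschitz_uncurry_of_norm_sub_le hC fun x x' u u' => hW.lipschitz x x' u u').continuous

/-- The upper derivatives of the four summands add up to the quadratic form of
`exists_composite_weights`, with the plant Lyapunov function in the role of `X`. Membership in the
zero-sum set enters only through the gradient-flow estimate. -/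
lemma exists_isDissipatedOn (hN : 0 < N) (h1 : P.SteadyStateAssumption) (h2 : P.CostAssumption)
    (h3 : P.GraphAssumption) (hr : 0 < r) (hC : 0 < C)
    (hW : IsPlantLyapunov P.plant P.steady W k r C) :
    ∃ A₁ > 0, ∃ A₂ > 0, ∀ α₁ ∈ Ioo 0 A₁, ∀ α₂ ∈ Ioo 0 A₂, ∃ a > 0, ∃ b > 0, ∃ c > 0, ∃ η > 0,
      IsDissipatedOn (P.closedLoop α₁ α₂) (zeroSumSet N n m d) (P.compositeLyapunov W a b c)
        (P.dissipationRate W η) := by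
  obtain ⟨l, hl, C₁, hC₁, hdis⟩ := exists_hasUpperDerivAt_disagreement hN h1 h2 h3
  obtain ⟨C₂, hC₂, hdir⟩ := exists_norm_gradSteady_direction_sub_le hN h1 h2
  have hW0 : ∀ x u, 0 ≤ W x u := fun x u => (norm_nonneg _).trans (hW.norm_le x u)
  -- One constant for all couplings: `C * (1 + C₂)` for the input speed acting on `W`, `C₁` for the
  -- disagreements, `C₂` for the gradient error.
  set K := C * (1 + C₂) + C₁ + C₂ with hK
  have hK0 : 0 < K := by positivity
  have hCK : C * (1 + C₂) ≤ K := by rw [hK]; linarith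
  have hC₁K : C₁ ≤ K := by
    have : 0 ≤ C * (1 + C₂) := by positivity
    rw [hK]; linarith
  have hC₂K : C₂ ≤ K := by
    have : 0 ≤ C * (1 + C₂) := by positivity
    rw [hK]; linarith
  clear_value K
  obtain ⟨A₁, hA₁, A₂, hA₂, hweights⟩ := exists_composite_weights hK0 hr hl
  refine ⟨A₁, hA₁, A₂, hA₂, fun α₁ hα₁ α₂ hα₂ => ?_⟩
  obtain ⟨a, ha, b, hb, c, hc, η, hη, hquad⟩ := hweights α₁ hα₁ α₂ hα₂
  have hα₁0 : 0 < α₁ := hα₁.1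
  have hα₂0 : 0 < α₂ := hα₂.1
  have hWc : Continuous fun q : ClosedLoopState N n m d => W q.1.1 q.1.2 :=
    (hW.continuous hC).comp continuous_fst
  have huc : Continuous fun q : ClosedLoopState N n m d => q.1.2 :=
    continuous_snd.comp continuous_fst
  have hYc := h2.continuous_aggDisagreement
  have hZc := h2.continuous_gradDisagreement
  refine ⟨a, ha, b, hb, c, hc, η, hη, ?_, ?_, fun q => ?_, fun q t T htT hq hS => ?_⟩
  · exact (((h2.differentiable_reduced.continuous.comp huc).add
      (continuous_const.mul (hWc.pow 2))).add (continuous_const.mul (hYc.pow 2))).add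
        (continuous_const.mul (hZc.pow 2))
  · exact continuous_const.mul ((((Continuous.comp (g := ∇ P.reducedCost)
      (continuous_gradient_reducedCost h1 h2) huc).norm.pow 2).add
        (hWc.pow 2)).add (hYc.pow 2) |>.add (hZc.pow 2))
  · exact mul_nonneg hη.le (by positivity)
  · have hd := hq.hasDerivWithinAt_Ici ⟨le_rfl, htT⟩
    obtain ⟨hY, hZ⟩ := hdis α₁ α₂ q t _ hα₁0 hα₂0 hd (hW.norm_le _ _)
    have hdirt := hdir (q t) (hS t ⟨le_rfl, htT.le⟩)
    rw [closedLoop_eq] at hd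
    have hx := hasDerivWithinAt_x hd
    have hu := hasDerivWithinAt_u hd
    dsimp only at hx hu
    generalize P.gradSteady (q t).1.2 (P.direction (q t).1.1 (P.aggEstimate (q t))
      (P.gradEstimate (q t))) = G at hdirt hu
    have hF : HasDerivWithinAt (fun s => P.reducedCost (q s).1.2)
        ⟪∇ P.reducedCost (q t).1.2, -(α₁ • G)⟫_ℝ (Ici t) t :=
      (h2.differentiable_reduced _).hasGradientAt.hasFDerivAt.comp_hasDerivWithinAt t hu
    have hWd := (hW.upperDeriv (fun s => (q s).1.1) (fun s => (q s).1.2) _ t hx hu).sq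
      (fun s => hW0 _ _)
    have hV := (((HasUpperDerivAt.of_hasDerivWithinAt hF).add (hWd.const_mul ha.le)).add
      (hY.const_mul hb.le)).add (hZ.const_mul hc.le)
    refine hV.mono ?_
    have hnorm := hW.norm_le (q t).1.1 (q t).1.2
    have hX0 := hW0 (q t).1.1 (q t).1.2
    have hY0 : 0 ≤ P.aggDisagreement (q t) := norm_nonneg _
    have hZ0 : 0 ≤ P.gradDisagreement (q t) := norm_nonneg _
    rw [dissipationRate]
    refine le_trans ?_ (hquad _ _ _ _)
    generalize W (q t).1.1 (q t).1.2 = X at *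
    generalize P.aggDisagreement (q t) = Y at *
    generalize P.gradDisagreement (q t) = Z at *
    generalize ∇ P.reducedCost (q t).1.2 = g at *
    have hGg : ‖G - g‖ ≤ C₂ * (X + Y + Z) := hdirt.trans (by gcongr)
    have e1 : ⟪g, -(α₁ • G)⟫_ℝ ≤ -α₁ * ‖g‖ ^ 2 + α₁ * (K * (‖g‖ * (X + Y + Z))) := by
      have h5 : ⟪g, G⟫_ℝ = ‖g‖ ^ 2 + ⟪g, G - g⟫_ℝ := by
        rw [inner_sub_right, real_inner_self_eq_norm_sq]; ring
      have h6 : -⟪g, G - g⟫_ℝ ≤ K * (‖g‖ * (X + Y + Z)) := by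
        calc -⟪g, G - g⟫_ℝ ≤ |⟪g, G - g⟫_ℝ| := neg_le_abs _
          _ ≤ ‖g‖ * ‖G - g‖ := abs_real_inner_le_norm _ _
          _ ≤ ‖g‖ * (K * (X + Y + Z)) := by
            gcongr
            exact hGg.trans (by gcongr)
          _ = _ := by ring
      rw [inner_neg_right, inner_smul_right, h5]
      have := mul_le_mul_of_nonneg_left h6 hα₁0.le
      linarith
    have e2 : C * ‖-(α₁ • G)‖ ≤ K * (α₁ * (‖g‖ + X + Y + Z)) := by
      rw [norm_neg, norm_smul, Real.norm_of_nonneg hα₁0.le]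
      have h5 : ‖G‖ ≤ (1 + C₂) * (‖g‖ + X + Y + Z) := by
        have h6 := norm_le_norm_sub_add G g
        have h7 : 0 ≤ C₂ * ‖g‖ := by positivity
        linarith
      calc C * (α₁ * ‖G‖) ≤ C * (α₁ * ((1 + C₂) * (‖g‖ + X + Y + Z))) := by gcongr
        _ = C * (1 + C₂) * (α₁ * (‖g‖ + X + Y + Z)) := by ring
        _ ≤ _ := by gcongr
    gcongr

lemma compositeLyapunov_exactState (hN : 0 < N) (hW : IsPlantLyapunov P.plant P.steady W k r C)
    (a b c : ℝ) (u : Stack N m) :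
    P.compositeLyapunov W a b c (P.exactState u) = P.reducedCost u := by
  have h0 : W (P.steady u) u = 0 :=
    le_antisymm (by simpa using hW.le_norm (P.steady u) u)
      ((norm_nonneg _).trans (hW.norm_le (P.steady u) u))
  rw [compositeLyapunov, aggDisagreement_exactState hN, gradDisagreement_exactState hN]
  simp [exactState, h0]

lemma reducedCost_le_compositeLyapunov {a b c : ℝ} (ha : 0 < a) (hb : 0 < b) (hc : 0 < c)
    (q : ClosedLoopState N n m d) : P.reducedCost q.1.2 ≤ P.compositeLyapunov W a b c q := by
  have e1 : 0 ≤ a * W q.1.1 q.1.2 ^ 2 := by positivity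
  have e2 : 0 ≤ b * P.aggDisagreement q ^ 2 := by positivity
  have e3 : 0 ≤ c * P.gradDisagreement q ^ 2 := by positivity
  rw [compositeLyapunov]
  linarith

lemma eq_exactState_of_eq_zero (hW : IsPlantLyapunov P.plant P.steady W k r C)
    {q : ClosedLoopState N n m d} (hq : q ∈ zeroSumSet N n m d) (hX : W q.1.1 q.1.2 = 0)
    (hY : P.aggDisagreement q = 0) (hZ : P.gradDisagreement q = 0) :
    q = P.exactState q.1.2 :=
  eq_of_disagreement_eq_zero hq (norm_le_zero_iff.1 ((hW.norm_le _ _).trans hX.le)) hY hZ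

lemma eq_exactState_of_compositeLyapunov_le (hW : IsPlantLyapunov P.plant P.steady W k r C)
    {a b c : ℝ} (ha : 0 < a) (hb : 0 < b) (hc : 0 < c) {q : ClosedLoopState N n m d}
    (hq : q ∈ zeroSumSet N n m d) (hV : P.compositeLyapunov W a b c q ≤ P.reducedCost q.1.2) :
    q = P.exactState q.1.2 := by
  have e1 : 0 ≤ a * W q.1.1 q.1.2 ^ 2 := by positivity
  have e2 : 0 ≤ b * P.aggDisagreement q ^ 2 := by positivity
  have e3 : 0 ≤ c * P.gradDisagreement q ^ 2 := by positivity
  rw [compositeLyapunov] at hV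
  have f1 : a * W q.1.1 q.1.2 ^ 2 = 0 := by linarith
  have f2 : b * P.aggDisagreement q ^ 2 = 0 := by linarith
  have f3 : c * P.gradDisagreement q ^ 2 = 0 := by linarith
  exact eq_exactState_of_eq_zero hW hq (by simpa [ha.ne'] using f1) (by simpa [hb.ne'] using f2)
    (by simpa [hc.ne'] using f3)

lemma eq_exactState_of_dissipationRate_eq_zero (hW : IsPlantLyapunov P.plant P.steady W k r C)
    {η : ℝ} (hη : 0 < η) {q : ClosedLoopState N n m d} (hq : q ∈ zeroSumSet N n m d)
    (h0 : P.dissipationRate W η q = 0) :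
    ∇ P.reducedCost q.1.2 = 0 ∧ q = P.exactState q.1.2 := by
  rw [dissipationRate, mul_eq_zero, or_iff_right hη.ne'] at h0
  have e0 := sq_nonneg ‖∇ P.reducedCost q.1.2‖
  have e1 := sq_nonneg (W q.1.1 q.1.2)
  have e2 := sq_nonneg (P.aggDisagreement q)
  have e3 := sq_nonneg (P.gradDisagreement q)
  refine ⟨norm_eq_zero.1 (pow_eq_zero_iff two_ne_zero |>.1 (by linarith)),
    eq_exactState_of_eq_zero hW hq ?_ ?_ ?_⟩ <;>
  exact pow_eq_zero_iff two_ne_zero |>.1 (by linarith)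

/-- Radial unboundedness bounds the input. On that ball the reduced cost is bounded below, which
bounds each square; the states then lie in the continuous image of a compact ball. -/
lemma isBounded_compositeLyapunov_le (h1 : P.SteadyStateAssumption) (h2 : P.CostAssumption)
    (hW : IsPlantLyapunov P.plant P.steady W k r C) {a b c : ℝ} (ha : 0 < a) (hb : 0 < b)
    (hc : 0 < c) (v : ℝ) :
    IsBounded {q ∈ zeroSumSet N n m d | P.compositeLyapunov W a b c q ≤ v} := by
  obtain ⟨R, hR⟩ : ∃ R, ∀ u, P.reducedCost u ≤ v → ‖u‖ ≤ R := by
    have h := h2.radially_unbounded.eventually_gt_atTop v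
    have hb : IsBounded {u | v < P.reducedCost u}ᶜ := isBounded_compl_iff.2 h
    obtain ⟨R, hR⟩ := hb.exists_norm_le
    exact ⟨R, fun u hu => hR u (not_lt.2 hu)⟩
  obtain ⟨M, hM⟩ := (isCompact_closedBall (0 : Stack N m) R).exists_bound_of_continuousOn
    h2.differentiable_reduced.continuous.continuousOn
  -- The inequality `y ≤ y ^ 2 + 1` replaces a square root.
  have hsq : ∀ {e y : ℝ}, 0 < e → e * y ^ 2 ≤ v + M → y ≤ (v + M) / e + 1 := by
    intro e y he h
    have h' : y ^ 2 ≤ (v + M) / e := by rw [le_div_iff₀ he]; linarith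
    nlinarith [sq_nonneg (y - 1)]
  set B := max (max ((v + M) / a + 1) R) (max ((v + M) / b + 1) ((v + M) / c + 1))
  refine ((isCompact_closedBall (0 : ClosedLoopState N n m d) B).image
    (continuous_reconstruct h1 h2)).isBounded.subset fun q hq => ?_
  refine ⟨_, ?_, reconstruct_eq hq.1⟩
  have hu := hR q.1.2 ((reducedCost_le_compositeLyapunov ha hb hc q).trans hq.2)
  have hF := hM q.1.2 (mem_closedBall_zero_iff.2 hu)
  rw [Real.norm_eq_abs, abs_le] at hF
  have hV := hq.2
  have e1 : 0 ≤ a * W q.1.1 q.1.2 ^ 2 := by positivity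
  have e2 : 0 ≤ b * P.aggDisagreement q ^ 2 := by positivity
  have e3 : 0 ≤ c * P.gradDisagreement q ^ 2 := by positivity
  rw [compositeLyapunov] at hV
  rw [mem_closedBall_zero_iff]
  have f1 : W q.1.1 q.1.2 ≤ (v + M) / a + 1 := hsq ha (by linarith)
  have f2 : P.aggDisagreement q ≤ (v + M) / b + 1 := hsq hb (by linarith)
  have f3 : P.gradDisagreement q ≤ (v + M) / c + 1 := hsq hc (by linarith)
  exact max_le_max (max_le_max ((hW.norm_le _ _).trans f1) hu) (max_le_max f2 f3)

end Composite

/-- Near an isolated stationary point that is a local minimum, the function is larger. -/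
lemma _root_.IsIsolatedStationaryPoint.exists_forall_lt {E : Type*} [NormedAddCommGroup E]
    [InnerProductSpace ℝ E] [CompleteSpace E] {J : E → ℝ} {u : E}
    (hu : IsIsolatedStationaryPoint J u) (hmin : IsLocalMin J u) :
    ∃ ρ > 0, ∀ y ∈ Metric.closedBall u ρ, y ≠ u → ∇ J y ≠ 0 ∧ J u < J y := by
  have h := (eventually_nhdsWithin_iff.1 hu.2).and hmin
  obtain ⟨ε, hε, h⟩ := Metric.eventually_nhds_iff_ball.1 h
  refine ⟨ε / 2, by positivity, fun y hy hyu => ?_⟩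
  have hyε : y ∈ Metric.ball u ε := Metric.closedBall_subset_ball (by linarith) hy
  have hgrad := (h y hyε).1 hyu
  -- At equal value `y` would be a local minimum too, hence a second stationary point in the
  -- neighbourhood.
  refine ⟨hgrad, lt_of_le_of_ne (h y hyε).2 fun heq => hgrad ?_⟩
  have hymin : IsLocalMin J y := by
    filter_upwards [Metric.isOpen_ball.mem_nhds hyε] with z hz
    exact heq ▸ (h z hz).2
  rw [gradient, hymin.fderiv_eq_zero, map_zero]

end AgentNetwork

/-! ### Boundedness, convergence, existence and stability from the composite Lyapunov function. -/

theorem theorem1 {N : ℕ} (hN : 0 < N) {n m : Fin N → ℕ} {d : ℕ} (P : AgentNetwork N n m d)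
    (h1 : P.SteadyStateAssumption) (h2 : P.CostAssumption) (h3 : P.GraphAssumption) :
    ∃ αbar₁ > (0 : ℝ), ∃ αbar₂ > (0 : ℝ), ∀ α₁ ∈ Ioo 0 αbar₁, ∀ α₂ ∈ Ioo 0 αbar₂,
      -- trajectories starting with `w = z = 0` are bounded (no finite escape time) ...
      (∀ (x₀ : Stack N n) (u₀ : Stack N m) (T : EReal) (q : ℝ → ClosedLoopState N n m d),
        IsSolutionOn (P.closedLoop α₁ α₂) (timeInterval T) q → q 0 = ((x₀, u₀), (0, 0)) →
          IsBounded (q '' timeInterval T)) ∧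
      -- ... and converge
      (∀ (x₀ : Stack N n) (u₀ : Stack N m) (q : ℝ → ClosedLoopState N n m d),
        IsSolutionOn (P.closedLoop α₁ α₂) (timeInterval ⊤) q → q 0 = ((x₀, u₀), (0, 0)) →
          Tendsto (fun t => Metric.infEDist (P.errorVector (q t))
            (P.stationarySet ×ˢ ({(0, 0)} : Set (Stack N (fun _ => d) × Stack N (fun _ => d)))))
            atTop (𝓝 0)) ∧
      -- trajectories exist for all times if the feedback law is locally Lipschitz
      ((∀ i, LocallyLipschitz (P.gradh i)) → (∀ i, LocallyLipschitz (P.gradφ i)) →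
        ∀ q₀ ∈ zeroSumSet N n m d, ∃ q : ℝ → ClosedLoopState N n m d,
          IsSolutionOn (P.closedLoop α₁ α₂) (timeInterval ⊤) q ∧ q 0 = q₀) ∧
      -- isolated stationary points that are local minima are asymptotically stable
      (∀ ubar : Stack N m, IsIsolatedStationaryPoint P.reducedCost ubar →
        IsLocalMin P.reducedCost ubar →
          IsLocallyAsymptoticallyStableOn (P.closedLoop α₁ α₂) (zeroSumSet N n m d)
            ((P.steady ubar, ubar), (P.piw (P.steady ubar), P.piz (P.steady ubar)))) := by
  obtain ⟨Lp, hLp, hpx, hpu⟩ := h1.exists_norm_plant_sub_le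
  obtain ⟨Lh, hLh, hh⟩ := h1.exists_norm_steady_sub_le
  obtain ⟨W, k, -, r, hr, C, hC, hW⟩ :=
    (h1.stable_plant hN).exists_isPlantLyapunov hLp hLh hpx hpu hh
  obtain ⟨A₁, hA₁, A₂, hA₂, hdiss⟩ :=
    AgentNetwork.exists_isDissipatedOn hN h1 h2 h3 hr hC hW
  refine ⟨A₁, hA₁, A₂, hA₂, fun α₁ hα₁ α₂ hα₂ => ?_⟩
  obtain ⟨a, ha, b, hb, c, hc, η, hη, hV⟩ := hdiss α₁ hα₁ α₂ hα₂
  have hinv : ∀ (T : EReal) (q : ℝ → ClosedLoopState N n m d),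
      IsSolutionOn (P.closedLoop α₁ α₂) (timeInterval T) q → q 0 ∈ zeroSumSet N n m d →
      ∀ t ∈ timeInterval T, q t ∈ zeroSumSet N n m d := fun T q hq h0 t ht =>
    h3.mem_zeroSumSet hN (hq.mono (Icc_subset_timeInterval ht)) h0 ht.1
  have hlevel := AgentNetwork.isBounded_compositeLyapunov_le h1 h2 hW ha hb hc
  have hstay : ∀ (T : ℝ) (q : ℝ → ClosedLoopState N n m d),
      IsSolutionOn (P.closedLoop α₁ α₂) (Icc 0 T) q → q 0 ∈ zeroSumSet N n m d → 0 ≤ T →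
      q T ∈ {y ∈ zeroSumSet N n m d |
        P.compositeLyapunov W a b c y ≤ P.compositeLyapunov W a b c (q 0)} := by
    intro T q hq h0 hT
    exact ⟨h3.mem_zeroSumSet hN hq h0 hT, hV.antitone hT hq fun t ht =>
      h3.mem_zeroSumSet hN (hq.mono (Icc_subset_Icc_right ht.2)) h0 ht.1⟩
  have hzero : ∀ (x₀ : Stack N n) (u₀ : Stack N m),
      (((x₀, u₀), (0, 0)) : ClosedLoopState N n m d) ∈ zeroSumSet N n m d := fun x₀ u₀ => by
    simp [zeroSumSet]
  have hfield : ∀ K : Set (ClosedLoopState N n m d), IsCompact K →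
      ∃ M, ∀ y ∈ K, y ∈ zeroSumSet N n m d → ‖P.closedLoop α₁ α₂ y‖ ≤ M := fun K hK => by
    obtain ⟨β, hβ, hle⟩ := AgentNetwork.exists_norm_closedLoop_le h1 h2 α₁ α₂
    obtain ⟨M, hM⟩ := hK.exists_bound_of_continuousOn hβ.continuousOn
    exact ⟨M, fun y hy _ => (hle y).trans ((le_abs_self _).trans (hM y hy))⟩
  refine ⟨fun x₀ u₀ T q hq h0 => ?_, fun x₀ u₀ q hq h0 => ?_, fun hlh hlφ q₀ hq₀ => ?_,
    fun u hu hmin => ?_⟩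
  · refine (hlevel (P.compositeLyapunov W a b c (q 0))).subset ?_
    rintro _ ⟨t, ht, rfl⟩
    exact hstay t q (hq.mono (Icc_subset_timeInterval ht)) (h0 ▸ hzero x₀ u₀) ht.1
  · have hq0 : q 0 ∈ zeroSumSet N n m d := h0 ▸ hzero x₀ u₀
    have hK := (hlevel (P.compositeLyapunov W a b c (q 0))).isCompact_closure
    obtain ⟨M, hM⟩ := hfield _ hK
    have hstay' : ∀ t, 0 ≤ t → q t ∈ _ := fun t ht =>
      hstay t q (hq.Icc_of_timeInterval_top t) hq0 ht
    refine hV.tendsto_infEDist hK hM AgentNetwork.isClosed_zeroSumSet (by rwa [timeInterval_top] at hq)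
      (fun t ht => subset_closure (hstay' t ht)) (fun t ht => (hstay' t ht).1)
      h2.continuous_errorVector fun y _ hyS hy0 => ?_
    obtain ⟨hg, hy⟩ := AgentNetwork.eq_exactState_of_dissipationRate_eq_zero hW hη hyS hy0
    rw [hy]
    exact AgentNetwork.errorVector_exactState_mem h1 h2 hg
  · refine (AgentNetwork.locallyLipschitz_closedLoop h1 h2 hlh hlφ
      α₁ α₂).exists_isSolutionOn_timeInterval_top fun T => ?_
    -- The sublevel set of the initial state bounds every solution, uniformly in the length of its
    -- interval.
    obtain ⟨R, hR⟩ := (hlevel (P.compositeLyapunov W a b c q₀)).exists_norm_le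
    refine ⟨R, fun T' hT' q hq h0 => hR _ ?_⟩
    have := hstay T' q hq (h0 ▸ hq₀) hT'.1
    rwa [h0] at this
  · obtain ⟨ρ, hρ, hnear⟩ := hu.exists_forall_lt hmin
    have hdist : ∀ y ∈ Metric.closedBall (P.exactState u) ρ, y.1.2 ∈ Metric.closedBall u ρ :=
      fun y hy => show dist y.1.2 (P.exactState u).1.2 ≤ ρ from
        ((le_max_right (dist y.1.1 _) _).trans (le_max_left _ (dist y.2 _))).trans hy
    refine hV.isLocallyAsymptoticallyStableOn AgentNetwork.isClosed_zeroSumSet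
      (AgentNetwork.exactState_mem_zeroSumSet hN u)
      (AgentNetwork.closedLoop_exactState h1 h2 hu.1 α₁ α₂) hinv
      (fun R => hfield _ (isCompact_closedBall _ R)) hρ (fun y hy hyS hye => ?_)
      fun y hy hyS hy0 => ?_
    · change P.compositeLyapunov W a b c (P.exactState u) < _
      rw [AgentNetwork.compositeLyapunov_exactState hN hW]
      -- If the input is `u`, the squares must be positive, otherwise `y` would be the equilibrium;
      -- if not, the reduced cost alone is already strictly larger.
      by_cases hyu : y.1.2 = u
      · by_contra hcon
        have := AgentNetwork.eq_exactState_of_compositeLyapunov_le hW ha hb hc hyS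
          (by rw [hyu]; exact not_lt.1 hcon)
        rw [hyu] at this
        exact hye this
      · exact (hnear _ (hdist y hy) hyu).2.trans_le
          (AgentNetwork.reducedCost_le_compositeLyapunov ha hb hc y)
    · obtain ⟨hg, hy'⟩ := AgentNetwork.eq_exactState_of_dissipationRate_eq_zero hW hη hyS hy0
      have hyu : y.1.2 = u := by
        by_contra hyu
        exact (hnear _ (hdist y hy) hyu).1 hg
      rw [hyu] at hy'
      exact hy'

end
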